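/- Let $L\ge 1$ and let the sites $x=1,\dots,L$ form a ring (addition of sites is modulo $L$). On $\mathcal H_L=\bigotimes_{x=1}^L\mathbb C^2$, where $\mathbb C^2$ has the orthonormal basis $|0\rangle,|1\rangle$, let $\sigma_x^-$ be the operator acting at site $x$ by $|1\rangle\mapsto|0\rangle$, $|0\rangle\mapsto 0$, and let $n_x=(\sigma_x^-)^*\sigma_x^-$. For $\lambda\in\mathbb C$ and $\kappa\ge 0$ put $$q_x=\sigma^-_{x+1}\sigma^-_{x+2}-\lambda\,\sigma^-_x\sigma^-_{x+3},\qquad H^{\mathrm{per}}_{\Lambda_L}=\sum_{x=1}^L\bigl(n_xn_{x+2}+\kappa\,q_x^*q_x\bigr),$$ the periodic truncated $\nu=1/3$ Haldane spin chain, and let $\operatorname{gap}(H)$ denote the distance from the lowest eigenvalue of $H$ to the rest of its spectrum. For $r\ge0$ let $\beta_\pm=\tfrac12(1\pm\sqrt{1+4r})$, $\beta=\beta_- /\beta_+$, $\beta_k=\beta_k(r)=\frac1{\beta_+}\frac{1-\beta^k}{1-\beta^{k+1}}$ for $k\ge1$, and for $k\ge4$ $$f_k(r)=r\,\beta_k\beta_{k-2}\left(\frac{[1-\beta_{k-1}(1+r)]^2}{1+2r}+\beta_{k-3}\frac{r(1-\beta_{k-1})^2}{1+r}\right).$$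 **Theorem.** The supremum $f(r)=\sup_{k\ge4}f_k(r)$ is finite for every $r\ge0$, and it defines a monotone increasing function $f:[0,\infty)\to[0,\infty)$ with the following properties. 1. For all $\lambda\in\mathbb C$ with $\lambda\ne0$ and $f(|\lambda|^2)<1/3$ and all $\kappa\ge0$, $$\liminf_{L\to\infty}\operatorname{gap}(H^{\mathrm{per}}_{\Lambda_L})\ \ge\ b(\kappa,\lambda):=\min\left\{\gamma^{\mathrm{per}},\ \frac{\kappa}{6(1+2|\lambda|^2)}\Bigl(1-\sqrt{3f(|\lambda|^2)}\Bigr)^2\right\},$$ where $$\gamma^{\mathrm{per}}=\frac13\min\left\{1,\ \frac{\kappa}{2+2\kappa|\lambda|^2},\ \frac{\kappa}{1+\kappa}\right\}.$$ 2. The bound stays positive as $\lambda\to0$: one has $f(|\lambda|^2)<1/3$ for all sufficiently small $\lambda\neq 0$, and for every $\kappa>0$ $$\lim_{\lambda\to0,\ \lambda\ne0}b(\kappa,\lambda)=\frac13\min\left\{1,\frac\kappa2,\frac{\kappa}{1+\kappa}\right\}>0.$$ -/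

import Mathlib

open scoped Topology NNReal

namespace Haldane

/-- Occupation configurations of the ring of `L` sites. They label the orthonormal occupation basis
`|μ⟩` of the `L`-fold tensor product of `ℂ²`; operators on that Hilbert space are written as
matrices in this basis. Sites are numbered `0, …, L - 1`. -/
abbrev Config (L : ℕ) : Type := Fin L → Fin 2

/-- The site `x + d` of the ring, addition being modulo `L`. -/
def ringShift {L : ℕ} (x : Fin L) (d : ℕ) : Fin L :=
  ⟨(x.val + d) % L, Nat.mod_lt _ x.pos⟩

/-- The operator `1 ⊗ ⋯ ⊗ a ⊗ ⋯ ⊗ 1` in which the `2 × 2` matrix `a` acts on the factor at the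
site `x`. -/
def siteOp {L : ℕ} (x : Fin L) (a : Matrix (Fin 2) (Fin 2) ℂ) :
    Matrix (Config L) (Config L) ℂ :=
  Matrix.of fun μ ν => if ∀ y, y ≠ x → μ y = ν y then a (μ x) (ν x) else 0

/-- The spin lowering operator at the site `x`: it sends `|1⟩` to `|0⟩` and kills `|0⟩`
(rows and columns of the `2 × 2` matrix are indexed by the occupation number `0, 1`). -/
def lower {L : ℕ} (x : Fin L) : Matrix (Config L) (Config L) ℂ :=
  siteOp x !![0, 1; 0, 0]

/-- The occupation number operator at the site `x` (raising after lowering). -/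
def number {L : ℕ} (x : Fin L) : Matrix (Config L) (Config L) ℂ :=
  (lower x).conjTranspose * lower x

/-- The dipole operator `q_x = σ⁻_{x+1} σ⁻_{x+2} - lam σ⁻_x σ⁻_{x+3}` on the ring. -/
def dipole {L : ℕ} (lam : ℂ) (x : Fin L) : Matrix (Config L) (Config L) ℂ :=
  lower (ringShift x 1) * lower (ringShift x 2) - lam • (lower x * lower (ringShift x 3))

/-- The spin chain `∑_x (n_x n_{x+2} + κ q_x^* q_x)` on the ring of `L` sites. -/
noncomputable def periodicHamiltonian (L : ℕ) (κ : ℝ) (lam : ℂ) :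
    Matrix (Config L) (Config L) ℂ :=
  ∑ x : Fin L, (number x * number (ringShift x 2) +
    (κ : ℂ) • ((dipole lam x).conjTranspose * dipole lam x))

/-- The lowest point of the (real) spectrum. -/
noncomputable def groundEnergy {ι : Type*} [Fintype ι] [DecidableEq ι] (H : Matrix ι ι ℂ) : ℝ :=
  sInf (spectrum ℝ H)

/-- The spectral gap: the distance from the ground state energy to the rest of the spectrum. -/
noncomputable def spectralGap {ι : Type*} [Fintype ι] [DecidableEq ι] (H : Matrix ι ι ℂ) : ℝ :=
  sInf {δ : ℝ | 0 < δ ∧ groundEnergy H + δ ∈ spectrum ℝ H}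

/-- `β₊ = (1 + √(1 + 4 r)) / 2`. -/
noncomputable def betaPlus (r : ℝ) : ℝ := (1 + √(1 + 4 * r)) / 2

/-- `β₋ = (1 - √(1 + 4 r)) / 2`. -/
noncomputable def betaMinus (r : ℝ) : ℝ := (1 - √(1 + 4 * r)) / 2

/-- `β_n = (1 / β₊) (1 - β ^ n) / (1 - β ^ (n + 1))` with `β = β₋ / β₊`. -/
noncomputable def betaSeq (n : ℕ) (r : ℝ) : ℝ :=
  1 / betaPlus r * ((1 - (betaMinus r / betaPlus r) ^ n) /
    (1 - (betaMinus r / betaPlus r) ^ (n + 1)))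

/-- The functions `f_k`, used only for `k ≥ 4`. -/
noncomputable def fSeq (k : ℕ) (r : ℝ) : ℝ :=
  r * betaSeq k r * betaSeq (k - 2) r *
    ((1 - betaSeq (k - 1) r * (1 + r)) ^ 2 / (1 + 2 * r) +
      betaSeq (k - 3) r * (r * (1 - betaSeq (k - 1) r) ^ 2 / (1 + r)))

/-- `γ^per = (1/3) min {1, κ / (2 + 2 κ |lam|²), κ / (1 + κ)}`. -/
noncomputable def gammaPer (κ : ℝ) (lam : ℂ) : ℝ :=
  1 / 3 * min 1 (min (κ / (2 + 2 * κ * ‖lam‖ ^ 2)) (κ / (1 + κ)))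

/-- The lower bound on the bulk gap, as a function of the value `v` of `f` at `|lam|²`:
`min {γ^per, κ / (6 (1 + 2 |lam|²)) (1 - √(3 v))²}`. -/
noncomputable def gapBound (κ : ℝ) (lam : ℂ) (v : ℝ) : ℝ :=
  min (gammaPer κ lam) (κ / (6 * (1 + 2 * ‖lam‖ ^ 2)) * (1 - √(3 * v)) ^ 2)

end Haldane

namespace Haldane

/-! The function `f`. The numbers β_k obey β_{k+1}(1 + rβ_k) = 1, and this recursion collapses f_k
to r²(1 - β_{k-2})(1 - β_{k-1}) / ((1 + r)(1 + 2r)) (`fSeq_eq`). Each factor is nonnegative and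
increasing in r, and the product is at most r². Hence the supremum is finite, monotone and O(r²),
which also gives the statements about λ → 0 by continuity.

The gap. For every L ≥ 30, λ ≠ 0 and κ > 0 the spectrum consists of 0 and points that are at least
min{1/(2 + 4/κ + 2|λ|²), κ/(1 + |λ|²)} (`mem_spectrum_periodicHamiltonian`), and this number
dominates b(κ,λ) (`gapBound_le`); the hypothesis f < 1/3 serves only to keep (1 - √(3f))² at most 1.
Exchanging 0110 and 1001 maps tilings to tilings (`IsTiling.isTiling_toggle`), so the span of the
tilings and its orthogonal complement are both invariant and can be treated separately.

Off the tilings (`sum_norm_sq_le`), every configuration either pays electrostatic energy itself or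
reaches, by one or two exchanges, a configuration that does. Cauchy–Schwarz along this path bounds
the norm by the energy.

On the tilings, dividing amplitudes by λ to the number of dimers turns H/κ into the generator of a
reversible Markov chain that removes dimers at rate 1 and creates them at rate r = |λ|²
(`eigenvalue_of_tilings`). Its gap is bounded by a maximum principle for gradients: consider the
dimer removal along which an eigenfunction has its largest increment relative to a suitable local
length, and subtract the eigenvalue equations at its two ends. All other moves either commute with
this one, and then cannot hurt by maximality, or lie next to it; with the lengths of `weight` the
neighbours cost exactly so much that the eigenvalue is at least 1/(1 + r)
(`inv_one_add_le_of_isMax`). -/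

/-! ### The recursion for β_k and the function f -/

theorem one_le_betaPlus {r : ℝ} (hr : 0 ≤ r) : 1 ≤ betaPlus r := by
  have : 1 ≤ √(1 + 4 * r) := Real.one_le_sqrt.2 (by linarith)
  unfold betaPlus; linarith

theorem betaRatio_mem {r : ℝ} (hr : 0 ≤ r) :
    -1 < betaMinus r / betaPlus r ∧ betaMinus r / betaPlus r ≤ 0 := by
  have h1 : 1 ≤ √(1 + 4 * r) := Real.one_le_sqrt.2 (by linarith)
  have h2 := one_le_betaPlus hr
  constructor
  · rw [lt_div_iff₀ (by linarith)]
    unfold betaPlus betaMinus; linarith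
  · exact div_nonpos_of_nonpos_of_nonneg (by unfold betaMinus; linarith) (by linarith)

theorem betaPlus_mul_one_add_ratio {r : ℝ} (hr : 0 ≤ r) :
    betaPlus r * (1 + betaMinus r / betaPlus r) = 1 := by
  have h2 := one_le_betaPlus hr
  have h3 : betaPlus r ≠ 0 := by linarith
  have h4 : betaPlus r + betaMinus r = 1 := by unfold betaPlus betaMinus; ring
  field_simp
  exact h4

theorem betaPlus_sq_mul_ratio {r : ℝ} (hr : 0 ≤ r) :
    betaPlus r ^ 2 * (betaMinus r / betaPlus r) = -r := by
  have h2 := one_le_betaPlus hr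
  have h3 : betaPlus r ≠ 0 := by linarith
  have h4 : betaPlus r * betaMinus r = -r := by
    have := Real.sq_sqrt (show 0 ≤ 1 + 4 * r by linarith)
    unfold betaPlus betaMinus; linarith
  field_simp
  exact h4

theorem betaSeq_zero (r : ℝ) : betaSeq 0 r = 0 := by simp [betaSeq]

theorem betaSeq_succ_mul (n : ℕ) {r : ℝ} (hr : 0 ≤ r) :
    betaSeq (n + 1) r * (1 + r * betaSeq n r) = 1 := by
  obtain ⟨hb1, hb2⟩ := betaRatio_mem hr
  have hp := betaPlus_mul_one_add_ratio hr
  have hq := betaPlus_sq_mul_ratio hr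
  have hpp := one_le_betaPlus hr
  unfold betaSeq
  generalize betaMinus r / betaPlus r = β at *
  generalize betaPlus r = p at *
  have hne : ∀ m : ℕ, 1 - β ^ (m + 1) ≠ 0 := fun m h => by
    have h1 : |β ^ (m + 1)| < 1 := by
      rw [abs_pow]
      exact pow_lt_one₀ (abs_nonneg _) (by rw [abs_lt]; constructor <;> linarith) (by omega)
    have := le_abs_self (β ^ (m + 1))
    linarith
  have h1 := hne n
  have h2 := hne (n + 1)
  have hp0 : p ≠ 0 := by linarith
  have hr' : r = -(p ^ 2 * β) := by linarith
  rw [hr']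
  field_simp
  linear_combination (-(1 - β ^ (n + 1))) * hp

theorem betaSeq_nonneg (n : ℕ) {r : ℝ} (hr : 0 ≤ r) : 0 ≤ betaSeq n r := by
  induction n with
  | zero => exact (betaSeq_zero r).ge
  | succ n ih =>
    have h := betaSeq_succ_mul n hr
    by_contra! hlt
    have : 0 < 1 + r * betaSeq n r := by positivity
    nlinarith

theorem betaSeq_succ (n : ℕ) {r : ℝ} (hr : 0 ≤ r) :
    betaSeq (n + 1) r = 1 / (1 + r * betaSeq n r) := by
  have := betaSeq_nonneg n hr
  rw [eq_div_iff (by positivity)]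
  exact betaSeq_succ_mul n hr

theorem betaSeq_le_one (n : ℕ) {r : ℝ} (hr : 0 ≤ r) : betaSeq n r ≤ 1 := by
  cases n with
  | zero => simp [betaSeq_zero]
  | succ n =>
    have := betaSeq_nonneg n hr
    rw [betaSeq_succ n hr, div_le_one (by positivity)]
    have : 0 ≤ r * betaSeq n r := by positivity
    linarith

/-- The two claims carry each other through the induction: 1/(1 + rβ_n) decreases because rβ_n
increases, and r/(1 + rβ_n) increases because β_n decreases. -/
theorem betaSeq_antitone_and_mul_monotone (n : ℕ) {r s : ℝ} (hr : 0 ≤ r) (hrs : r ≤ s) :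
    betaSeq n s ≤ betaSeq n r ∧ r * betaSeq n r ≤ s * betaSeq n s := by
  have hs := hr.trans hrs
  induction n with
  | zero => simp [betaSeq_zero]
  | succ n ih =>
    have h1 := betaSeq_nonneg n hr
    have h2 := betaSeq_nonneg n hs
    rw [betaSeq_succ n hr, betaSeq_succ n hs]
    constructor
    · exact one_div_le_one_div_of_le (by positivity) (by linarith [ih.2])
    · rw [mul_one_div, mul_one_div, div_le_div_iff₀ (by positivity) (by positivity)]
      have : r * s * betaSeq n s ≤ r * s * betaSeq n r :=
        mul_le_mul_of_nonneg_left ih.1 (by positivity)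
      nlinarith

/-- By the recursion all the β's involved are rational functions of r and b = β_{m+1}, so this is an
identity of rational functions. In the factored form monotonicity and the bound r² can be read off
factor by factor. -/
theorem fSeq_eq (m : ℕ) {r : ℝ} (hr : 0 ≤ r) :
    fSeq (m + 4) r = r / (1 + r) * (r / (1 + 2 * r)) * (1 - betaSeq (m + 2) r) *
      (1 - betaSeq (m + 3) r) := by
  have h1 := betaSeq_nonneg (m + 1) hr
  have e2 := betaSeq_succ (m + 1) hr
  have e3 := betaSeq_succ (m + 2) hr
  have e4 := betaSeq_succ (m + 3) hr
  have g2 := betaSeq_nonneg (m + 2) hr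
  have g3 := betaSeq_nonneg (m + 3) hr
  have k4 : 1 + r * betaSeq (m + 3) r ≠ 0 := by positivity
  have k3 : 1 + r * betaSeq (m + 2) r ≠ 0 := by positivity
  unfold fSeq
  simp only [show m + 4 - 2 = m + 2 by omega, show m + 4 - 1 = m + 3 by omega,
    show m + 4 - 3 = m + 1 by omega]
  simp only [show m + 1 + 1 = m + 2 by omega, show m + 2 + 1 = m + 3 by omega,
    show m + 3 + 1 = m + 4 by omega] at e2 e3 e4
  generalize betaSeq (m + 1) r = b at *
  have e3' : betaSeq (m + 3) r = (1 + r * b) / (1 + r + r * b) := by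
    rw [e3, e2]; field_simp; ring
  have e4' : betaSeq (m + 4) r = (1 + r + r * b) / ((1 + 2 * r) + r * (1 + r) * b) := by
    rw [e4, e3']; field_simp; ring
  rw [e4', e3', e2]
  have n1 : 1 + r ≠ 0 := by positivity
  have n2 : 1 + 2 * r ≠ 0 := by positivity
  have n3 : 1 + r * b ≠ 0 := by positivity
  have n4 : 1 + r + r * b ≠ 0 := by positivity
  have n5 : (1 + 2 * r) + r * (1 + r) * b ≠ 0 := by positivity
  field_simp
  ring

theorem fSeq_nonneg (m : ℕ) {r : ℝ} (hr : 0 ≤ r) : 0 ≤ fSeq (m + 4) r := by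
  rw [fSeq_eq m hr]
  have h1 : 0 ≤ 1 - betaSeq (m + 2) r := sub_nonneg.2 (betaSeq_le_one _ hr)
  have h2 : 0 ≤ 1 - betaSeq (m + 3) r := sub_nonneg.2 (betaSeq_le_one _ hr)
  positivity

theorem fSeq_mono (m : ℕ) {r s : ℝ} (hr : 0 ≤ r) (hrs : r ≤ s) :
    fSeq (m + 4) r ≤ fSeq (m + 4) s := by
  have hs := hr.trans hrs
  rw [fSeq_eq m hr, fSeq_eq m hs]
  have h1 : 0 ≤ 1 - betaSeq (m + 2) r := sub_nonneg.2 (betaSeq_le_one _ hr)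
  have h2 : 0 ≤ 1 - betaSeq (m + 3) r := sub_nonneg.2 (betaSeq_le_one _ hr)
  have h3 := (betaSeq_antitone_and_mul_monotone (m + 2) hr hrs).1
  have h4 := (betaSeq_antitone_and_mul_monotone (m + 3) hr hrs).1
  have h5 : 0 ≤ 1 - betaSeq (m + 2) s := sub_nonneg.2 (betaSeq_le_one _ hs)
  have h6 : r / (1 + r) ≤ s / (1 + s) := by
    rw [div_le_div_iff₀ (by positivity) (by positivity)]; nlinarith
  have h7 : r / (1 + 2 * r) ≤ s / (1 + 2 * s) := by
    rw [div_le_div_iff₀ (by positivity) (by positivity)]; nlinarith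
  have h8 : 0 ≤ s / (1 + s) := by positivity
  have h9 : 0 ≤ s / (1 + 2 * s) := by positivity
  gcongr

theorem fSeq_le_sq (m : ℕ) {r : ℝ} (hr : 0 ≤ r) : fSeq (m + 4) r ≤ r ^ 2 := by
  rw [fSeq_eq m hr]
  have h1 : 0 ≤ 1 - betaSeq (m + 2) r := sub_nonneg.2 (betaSeq_le_one _ hr)
  have h2 : 0 ≤ 1 - betaSeq (m + 3) r := sub_nonneg.2 (betaSeq_le_one _ hr)
  have h3 := betaSeq_nonneg (m + 2) hr
  have h4 := betaSeq_nonneg (m + 3) hr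
  have h6 : r / (1 + r) ≤ r := div_le_self hr (by linarith)
  have h7 : r / (1 + 2 * r) ≤ r := div_le_self hr (by linarith)
  calc _ ≤ r * r * 1 * 1 := by gcongr <;> linarith
    _ = r ^ 2 := by ring

theorem exists_sup_fSeq : ∃ f : ℝ≥0 → ℝ≥0,
    (∀ r : ℝ≥0, IsLUB {y : ℝ | ∃ k : ℕ, 4 ≤ k ∧ y = fSeq k r} (f r)) ∧ Monotone f ∧
      ∀ r : ℝ≥0, (f r : ℝ) ≤ (r : ℝ) ^ 2 := by
  have hub : ∀ r : ℝ≥0, (r : ℝ) ^ 2 ∈ upperBounds {y : ℝ | ∃ k : ℕ, 4 ≤ k ∧ y = fSeq k r} := by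
    rintro r y ⟨k, hk, rfl⟩
    obtain ⟨m, rfl⟩ := Nat.exists_eq_add_of_le' hk
    exact fSeq_le_sq m r.2
  have hlub : ∀ r : ℝ≥0, ∃ y : ℝ≥0,
      IsLUB {y : ℝ | ∃ k : ℕ, 4 ≤ k ∧ y = fSeq k r} (y : ℝ) := by
    intro r
    have h := isLUB_csSup (s := {y : ℝ | ∃ k : ℕ, 4 ≤ k ∧ y = fSeq k r})
      ⟨_, 4, le_rfl, rfl⟩ ⟨_, hub r⟩
    exact ⟨⟨_, (fSeq_nonneg 0 r.2).trans (h.1 ⟨4, le_rfl, rfl⟩)⟩, h⟩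
  choose f hf using hlub
  refine ⟨f, hf, fun r s hrs => ?_, fun r => (hf r).2 (hub r)⟩
  rw [← NNReal.coe_le_coe]
  refine (hf r).2 ?_
  rintro y ⟨k, hk, rfl⟩
  obtain ⟨m, rfl⟩ := Nat.exists_eq_add_of_le' hk
  exact (fSeq_mono m r.2 hrs).trans ((hf s).1 ⟨m + 4, hk, rfl⟩)

/-! ### The limit λ → 0 of the bound -/

theorem tendsto_norm_punctured_nhds_zero :
    Filter.Tendsto (fun lam : ℂ => ‖lam‖) (𝓝[≠] 0) (𝓝 0) := by
  have : Continuous fun lam : ℂ => ‖lam‖ := continuous_norm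
  simpa using (this.tendsto 0).mono_left nhdsWithin_le_nhds

theorem tendsto_sup_fSeq {f : ℝ≥0 → ℝ≥0} (hf : ∀ r : ℝ≥0, (f r : ℝ) ≤ (r : ℝ) ^ 2) :
    Filter.Tendsto (fun lam : ℂ => (f (‖lam‖₊ ^ 2) : ℝ)) (𝓝[≠] 0) (𝓝 0) := by
  have h4 : Filter.Tendsto (fun lam : ℂ => (‖lam‖ ^ 2) ^ 2) (𝓝[≠] 0) (𝓝 0) := by
    simpa using (tendsto_norm_punctured_nhds_zero.pow 2).pow 2
  refine squeeze_zero (fun _ => NNReal.coe_nonneg _) (fun lam => ?_) h4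
  have := hf (‖lam‖₊ ^ 2)
  rwa [NNReal.coe_pow, coe_nnnorm] at this

theorem tendsto_gapBound {f : ℝ≥0 → ℝ≥0} (hf : ∀ r : ℝ≥0, (f r : ℝ) ≤ (r : ℝ) ^ 2) {κ : ℝ}
    (hκ : 0 < κ) :
    Filter.Tendsto (fun lam : ℂ => gapBound κ lam (f (‖lam‖₊ ^ 2))) (𝓝[≠] 0)
      (𝓝 (min 1 (min (κ / 2) (κ / (1 + κ))) / 3)) := by
  have key : Filter.Tendsto
      (fun p : ℝ × ℝ => min (1 / 3 * min 1 (min (κ / (2 + 2 * κ * p.1 ^ 2)) (κ / (1 + κ))))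
        (κ / (6 * (1 + 2 * p.1 ^ 2)) * (1 - √(3 * p.2)) ^ 2)) (𝓝 (0, 0))
      (𝓝 (min (1 / 3 * min 1 (min (κ / (2 + 2 * κ * (0 : ℝ) ^ 2)) (κ / (1 + κ))))
        (κ / (6 * (1 + 2 * (0 : ℝ) ^ 2)) * (1 - √(3 * 0)) ^ 2))) := by
    refine ContinuousAt.tendsto (x := ((0 : ℝ), (0 : ℝ))) (f := fun p : ℝ × ℝ =>
      min (1 / 3 * min 1 (min (κ / (2 + 2 * κ * p.1 ^ 2)) (κ / (1 + κ))))
        (κ / (6 * (1 + 2 * p.1 ^ 2)) * (1 - √(3 * p.2)) ^ 2)) ?_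
    refine Continuous.continuousAt ?_
    have h1 : ∀ p : ℝ × ℝ, 2 + 2 * κ * p.1 ^ 2 ≠ 0 := fun p => by positivity
    have h2 : ∀ p : ℝ × ℝ, 6 * (1 + 2 * p.1 ^ 2) ≠ 0 := fun p => by positivity
    fun_prop (disch := assumption)
  have h := key.comp (tendsto_norm_punctured_nhds_zero.prodMk_nhds (tendsto_sup_fSeq hf))
  have hval : min (1 / 3 * min 1 (min (κ / (2 + 2 * κ * (0 : ℝ) ^ 2)) (κ / (1 + κ))))
      (κ / (6 * (1 + 2 * (0 : ℝ) ^ 2)) * (1 - √(3 * 0)) ^ 2) =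
      min 1 (min (κ / 2) (κ / (1 + κ))) / 3 := by
    -- At λ = 0 the second entry of the outer minimum is κ/6, which is never smaller than the first.
    have e : min 1 (min (κ / 2) (κ / (1 + κ))) ≤ κ / 2 :=
      (min_le_right _ _).trans (min_le_left _ _)
    norm_num
    rw [min_eq_left (by linarith)]
    ring
  rw [hval] at h
  exact h

/-! ### Arithmetic of sites on the ring -/

section Ring

variable {L : ℕ}

theorem ringShift_ringShift (b : Fin L) (i j : ℕ) :
    ringShift (ringShift b i) j = ringShift b (i + j) := by
  ext
  simp [ringShift, add_assoc]

theorem ringShift_zero (b : Fin L) : ringShift b 0 = b := by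
  ext
  simpa [ringShift] using Nat.mod_eq_of_lt b.2

theorem ringShift_self (b : Fin L) : ringShift b L = b := by
  ext
  simpa [ringShift] using Nat.mod_eq_of_lt b.2

theorem ringShift_add_self (b : Fin L) (i : ℕ) : ringShift b (i + L) = ringShift b i := by
  rw [← ringShift_ringShift, ringShift_self]

theorem ringShift_inj (b : Fin L) {i j : ℕ} (hi : i < L) (hj : j < L) :
    ringShift b i = ringShift b j ↔ i = j := by
  refine ⟨fun h => ?_, fun h => h ▸ rfl⟩
  have h' : (b.val + i) % L = (b.val + j) % L := congrArg Fin.val h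
  have := Nat.ModEq.add_left_cancel' b.val h'
  rwa [Nat.ModEq, Nat.mod_eq_of_lt hi, Nat.mod_eq_of_lt hj] at this

theorem exists_eq_ringShift (b y : Fin L) : ∃ j < L, y = ringShift b j := by
  refine ⟨(y.val + (L - b.val)) % L, Nat.mod_lt _ b.pos, ?_⟩
  ext
  have h1 := b.2
  have h2 := y.2
  simp only [ringShift, Nat.add_mod_mod]
  rw [show b.val + (y.val + (L - b.val)) = y.val + L by omega, Nat.add_mod_right,
    Nat.mod_eq_of_lt h2]

theorem exists_ringShift_eq (x : Fin L) {i : ℕ} (hi : i ≤ L) : ∃ b, ringShift b i = x :=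
  ⟨ringShift x (L - i), by rw [ringShift_ringShift, Nat.sub_add_cancel hi, ringShift_self]⟩

theorem ringShift_ne {x : Fin L} (hL : 4 ≤ L) {i j : ℕ} (hi : i < 4) (hj : j < 4) (hij : i ≠ j) :
    ringShift x i ≠ ringShift x j := fun h =>
  hij ((ringShift_inj x (by omega) (by omega)).1 h)

theorem ringShift_ne_self {x : Fin L} (hL : 4 ≤ L) {i : ℕ} (hi : i < 4) (h0 : i ≠ 0) :
    ringShift x i ≠ x := by
  have := ringShift_ne (x := x) hL hi (show 0 < 4 by omega) h0
  rwa [ringShift_zero] at this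

end Ring

theorem fin_two_ne_one {a : Fin 2} : a ≠ 1 ↔ a = 0 := by omega

/-! ### Action of the local operators on amplitudes -/

section Operators

variable {L : ℕ}

theorem lower_apply (x : Fin L) (μ ν : Config L) :
    lower x μ ν = if μ x = 0 ∧ ν = Function.update μ x 1 then 1 else 0 := by
  have hiff : (∀ y, y ≠ x → μ y = ν y) ∧ μ x = 0 ∧ ν x = 1 ↔
      μ x = 0 ∧ ν = Function.update μ x 1 := by
    constructor
    · rintro ⟨h1, h2, h3⟩
      refine ⟨h2, ?_⟩
      rw [Function.eq_update_iff]
      exact ⟨h3, fun y hy => (h1 y hy).symm⟩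
    · rintro ⟨h2, h3⟩
      rw [Function.eq_update_iff] at h3
      exact ⟨fun y hy => (h3.2 y hy).symm, h2, h3.1⟩
  simp only [← hiff, lower, siteOp, Matrix.of_apply]
  by_cases h : ∀ y, y ≠ x → μ y = ν y
  · simp only [eq_true h, true_and]
    generalize μ x = a, ν x = b
    fin_cases a <;> fin_cases b <;> simp
  · rw [if_neg h, if_neg (fun h' => h h'.1)]

theorem lower_apply' (x : Fin L) (μ ν : Config L) :
    lower x μ ν = if ν x = 1 ∧ μ = Function.update ν x 0 then 1 else 0 := by
  rw [lower_apply]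
  congr 1
  rw [Function.eq_update_iff, Function.eq_update_iff, eq_iff_iff]
  constructor
  · rintro ⟨h1, h2, h3⟩
    exact ⟨h2, h1, fun y hy => (h3 y hy).symm⟩
  · rintro ⟨h1, h2, h3⟩
    exact ⟨h2, h1, fun y hy => (h3 y hy).symm⟩

theorem lower_mulVec (x : Fin L) (v : Config L → ℂ) (μ : Config L) :
    (lower x).mulVec v μ = if μ x = 0 then v (Function.update μ x 1) else 0 := by
  simp only [Matrix.mulVec, dotProduct, lower_apply, ite_and]
  split_ifs <;> simp

theorem lower_conjTranspose_mulVec (x : Fin L) (v : Config L → ℂ) (μ : Config L) :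
    (lower x).conjTranspose.mulVec v μ = if μ x = 1 then v (Function.update μ x 0) else 0 := by
  simp only [Matrix.mulVec, dotProduct, Matrix.conjTranspose_apply, lower_apply', ite_and]
  split_ifs <;> simp

theorem number_mulVec (x : Fin L) (v : Config L → ℂ) (μ : Config L) :
    (number x).mulVec v μ = if μ x = 1 then v μ else 0 := by
  rw [number, ← Matrix.mulVec_mulVec, lower_conjTranspose_mulVec]
  split_ifs with h
  · simp [lower_mulVec, ← h]
  · rfl

theorem number_mul_number_mulVec (x y : Fin L) (v : Config L → ℂ) (μ : Config L) :
    (number x * number y).mulVec v μ = if μ x = 1 ∧ μ y = 1 then v μ else 0 := by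
  rw [← Matrix.mulVec_mulVec, number_mulVec, number_mulVec, ite_and]

theorem dipole_mulVec (hL : 4 ≤ L) (lam : ℂ) (x : Fin L) (v : Config L → ℂ) (μ : Config L) :
    (dipole lam x).mulVec v μ =
      (if μ (ringShift x 1) = 0 ∧ μ (ringShift x 2) = 0 then
        v (Function.update (Function.update μ (ringShift x 1) 1) (ringShift x 2) 1) else 0) -
      lam * (if μ x = 0 ∧ μ (ringShift x 3) = 0 then
        v (Function.update (Function.update μ x 1) (ringShift x 3) 1) else 0) := by
  have h12 : ringShift x 2 ≠ ringShift x 1 := ringShift_ne hL (by omega) (by omega) (by omega)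
  have h03 : ringShift x 3 ≠ x := ringShift_ne_self hL (by omega) (by omega)
  rw [dipole, Matrix.sub_mulVec, Matrix.smul_mulVec, ← Matrix.mulVec_mulVec,
    ← Matrix.mulVec_mulVec]
  simp only [Pi.sub_apply, Pi.smul_apply, smul_eq_mul, lower_mulVec,
    Function.update_of_ne h12, Function.update_of_ne h03, ite_and]

theorem dipole_conjTranspose_mulVec (hL : 4 ≤ L) (lam : ℂ) (x : Fin L) (v : Config L → ℂ)
    (μ : Config L) :
    (dipole lam x).conjTranspose.mulVec v μ =
      (if μ (ringShift x 1) = 1 ∧ μ (ringShift x 2) = 1 then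
        v (Function.update (Function.update μ (ringShift x 1) 0) (ringShift x 2) 0) else 0) -
      star lam * (if μ x = 1 ∧ μ (ringShift x 3) = 1 then
        v (Function.update (Function.update μ x 0) (ringShift x 3) 0) else 0) := by
  have h12 : ringShift x 1 ≠ ringShift x 2 := ringShift_ne hL (by omega) (by omega) (by omega)
  have h03 : x ≠ ringShift x 3 := (ringShift_ne_self hL (by omega) (by omega)).symm
  rw [dipole, Matrix.conjTranspose_sub, Matrix.conjTranspose_smul, Matrix.conjTranspose_mul,
    Matrix.conjTranspose_mul, Matrix.sub_mulVec, Matrix.smul_mulVec, ← Matrix.mulVec_mulVec,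
    ← Matrix.mulVec_mulVec]
  simp only [Pi.sub_apply, Pi.smul_apply, smul_eq_mul, lower_conjTranspose_mulVec,
    Function.update_of_ne h12, Function.update_of_ne h03, ite_and]
  rw [Function.update_comm h12, Function.update_comm h03]
  congr 1
  · split_ifs <;> rfl
  · split_ifs <;> rfl

end Operators

/-! ### Exchanges 0110 ↔ 1001 and the invariance of tilings -/

section Moves

variable {L : ℕ}

/-- Exchanges occupied and empty sites in the block `x, …, x + 3`. -/
def toggle (x : Fin L) (X : Config L) : Config L := fun z =>
  if z = x ∨ z = ringShift x 1 ∨ z = ringShift x 2 ∨ z = ringShift x 3 then 1 - X z else X z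

/-- The configuration `X` reads `0110` on the block `x, …, x + 3`. -/
def IsDimer (X : Config L) (x : Fin L) : Prop :=
  X x ≠ 1 ∧ X (ringShift x 1) = 1 ∧ X (ringShift x 2) = 1 ∧ X (ringShift x 3) ≠ 1

/-- The configuration `X` reads `1001` on the block `x, …, x + 3`. -/
def IsMonomerPair (X : Config L) (x : Fin L) : Prop :=
  X x = 1 ∧ X (ringShift x 1) ≠ 1 ∧ X (ringShift x 2) ≠ 1 ∧ X (ringShift x 3) = 1

instance (X : Config L) (x : Fin L) : Decidable (IsDimer X x) := by
  unfold IsDimer; infer_instance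

instance (X : Config L) (x : Fin L) : Decidable (IsMonomerPair X x) := by
  unfold IsMonomerPair; infer_instance

/-- The configurations that arise from tilings of the ring by voids, monomers and dimers,
characterized by forbidden local patterns. -/
structure IsTiling (X : Config L) : Prop where
  no_two : ∀ y, X y = 1 → X (ringShift y 2) = 1 → False
  no_left : ∀ y, X y = 1 → X (ringShift y 1) = 1 → X (ringShift y 4) = 1 → False
  no_right : ∀ y, X y = 1 → X (ringShift y 3) = 1 → X (ringShift y 4) = 1 → False
  no_four : ∀ y, X y = 1 → X (ringShift y 1) = 1 → X (ringShift y 5) = 1 →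
    X (ringShift y 6) = 1 → False

theorem toggle_toggle (x : Fin L) (X : Config L) : toggle x (toggle x X) = X := by
  funext z
  unfold toggle
  split_ifs <;> simp

theorem toggle_comm (x y : Fin L) (X : Config L) : toggle x (toggle y X) = toggle y (toggle x X) := by
  funext z
  unfold toggle
  split_ifs <;> rfl

theorem fin_two_one_sub_eq_one {a : Fin 2} : 1 - a = 1 ↔ a ≠ 1 := by
  revert a; decide

/-- The block may wrap around the ring past the base point; `hij` ensures that its wrapped part
stays short of position `j`, so membership is decided by comparing integers. -/
theorem toggle_ringShift_eq_one (b : Fin L) (X : Config L) {i j : ℕ} (hi : i < L) (hj : j < L)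
    (hij : i + 3 < j + L) : toggle (ringShift b i) X (ringShift b j) = 1 ↔
      if i ≤ j ∧ j < i + 4 then X (ringShift b j) ≠ 1 else X (ringShift b j) = 1 := by
  have key : (ringShift b j = ringShift b i ∨ ringShift b j = ringShift (ringShift b i) 1 ∨
      ringShift b j = ringShift (ringShift b i) 2 ∨ ringShift b j = ringShift (ringShift b i) 3) ↔
      i ≤ j ∧ j < i + 4 := by
    have hk : ∀ k < 4, (ringShift b j = ringShift b (i + k) ↔ j = i + k) := by
      intro k hk
      by_cases hlt : i + k < L
      · exact ringShift_inj b hj hlt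
      · obtain ⟨m, hm⟩ := Nat.exists_eq_add_of_le' (not_lt.1 hlt)
        rw [hm, ringShift_add_self, ringShift_inj b hj (by omega)]
        omega
    have h0 := hk 0 (by omega)
    simp only [ringShift_ringShift, hk 1 (by omega), hk 2 (by omega), hk 3 (by omega),
      ringShift_inj b hj hi]
    omega
  unfold toggle
  simp only [key]
  split_ifs
  · exact fin_two_one_sub_eq_one
  · rfl

theorem toggle_apply_of_mem {x : Fin L} {X : Config L} {k : ℕ} (hk : k < 4) :
    toggle x X (ringShift x k) = 1 ↔ X (ringShift x k) ≠ 1 := by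
  unfold toggle
  rw [if_pos, fin_two_one_sub_eq_one]
  interval_cases k <;> simp [ringShift_zero]

theorem IsDimer.isMonomerPair_toggle {X : Config L} {x : Fin L} (h : IsDimer X x) :
    IsMonomerPair (toggle x X) x := by
  have h0 := toggle_apply_of_mem (x := x) (X := X) (k := 0) (by omega)
  rw [ringShift_zero] at h0
  obtain ⟨a, b, c, d⟩ := h
  refine ⟨h0.2 a, ?_, ?_, (toggle_apply_of_mem (by omega)).2 d⟩ <;>
  · rw [Ne, toggle_apply_of_mem (by omega)]; tauto

theorem IsMonomerPair.isDimer_toggle {X : Config L} {x : Fin L} (h : IsMonomerPair X x) :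
    IsDimer (toggle x X) x := by
  have h0 := toggle_apply_of_mem (x := x) (X := X) (k := 0) (by omega)
  rw [ringShift_zero] at h0
  obtain ⟨a, b, c, d⟩ := h
  refine ⟨by rw [Ne, h0]; tauto, (toggle_apply_of_mem (by omega)).2 b,
    (toggle_apply_of_mem (by omega)).2 c, ?_⟩
  rw [Ne, toggle_apply_of_mem (by omega)]; tauto

/-- A sequence of sites none of whose windows starts a pattern forbidden in `IsTiling`. -/
structure AvoidsPatterns (u : ℕ → Prop) : Prop where
  no_two : ∀ i, u i → u (i + 2) → False
  no_left : ∀ i, u i → u (i + 1) → u (i + 4) → False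
  no_right : ∀ i, u i → u (i + 3) → u (i + 4) → False
  no_four : ∀ i, u i → u (i + 1) → u (i + 5) → u (i + 6) → False

/-- This and the next three lemmas are finite checks. A pattern spans at most seven sites, so only
one starting at 3, …, 12 can meet the exchanged block 9, …, 12. Away from the block it suffices that
`w` has no more particles than `u`. -/
theorem AvoidsPatterns.no_two_of_exchange {u w : ℕ → Prop} (hu : AvoidsPatterns u)
    (hx : (¬ u 9 ∧ u 10 ∧ u 11 ∧ ¬ u 12) ∨ (u 9 ∧ ¬ u 10 ∧ ¬ u 11 ∧ u 12))
    (far : ∀ j, j < 9 ∨ 13 ≤ j ∧ j < 20 → (w j → u j))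
    (near : ∀ j, 9 ≤ j ∧ j < 13 → (w j ↔ ¬ u j)) {j : ℕ} (hj3 : 3 ≤ j) (hj : j < 13) :
    w j → w (j + 2) → False := by
  have n9 := near 9 (by omega)
  have n10 := near 10 (by omega)
  have n11 := near 11 (by omega)
  have n12 := near 12 (by omega)
  obtain ⟨f2, fl, fr, f4⟩ := hu
  clear near
  interval_cases j <;> grind

theorem AvoidsPatterns.no_left_of_exchange {u w : ℕ → Prop} (hu : AvoidsPatterns u)
    (hx : (¬ u 9 ∧ u 10 ∧ u 11 ∧ ¬ u 12) ∨ (u 9 ∧ ¬ u 10 ∧ ¬ u 11 ∧ u 12))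
    (far : ∀ j, j < 9 ∨ 13 ≤ j ∧ j < 20 → (w j → u j))
    (near : ∀ j, 9 ≤ j ∧ j < 13 → (w j ↔ ¬ u j)) {j : ℕ} (hj3 : 3 ≤ j) (hj : j < 13) :
    w j → w (j + 1) → w (j + 4) → False := by
  have n9 := near 9 (by omega)
  have n10 := near 10 (by omega)
  have n11 := near 11 (by omega)
  have n12 := near 12 (by omega)
  obtain ⟨f2, fl, fr, f4⟩ := hu
  clear near
  interval_cases j <;> grind

theorem AvoidsPatterns.no_right_of_exchange {u w : ℕ → Prop} (hu : AvoidsPatterns u)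
    (hx : (¬ u 9 ∧ u 10 ∧ u 11 ∧ ¬ u 12) ∨ (u 9 ∧ ¬ u 10 ∧ ¬ u 11 ∧ u 12))
    (far : ∀ j, j < 9 ∨ 13 ≤ j ∧ j < 20 → (w j → u j))
    (near : ∀ j, 9 ≤ j ∧ j < 13 → (w j ↔ ¬ u j)) {j : ℕ} (hj3 : 3 ≤ j) (hj : j < 13) :
    w j → w (j + 3) → w (j + 4) → False := by
  have n9 := near 9 (by omega)
  have n10 := near 10 (by omega)
  have n11 := near 11 (by omega)
  have n12 := near 12 (by omega)
  obtain ⟨f2, fl, fr, f4⟩ := hu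
  clear near
  interval_cases j <;> grind

theorem AvoidsPatterns.no_four_of_exchange {u w : ℕ → Prop} (hu : AvoidsPatterns u)
    (hx : (¬ u 9 ∧ u 10 ∧ u 11 ∧ ¬ u 12) ∨ (u 9 ∧ ¬ u 10 ∧ ¬ u 11 ∧ u 12))
    (far : ∀ j, j < 9 ∨ 13 ≤ j ∧ j < 20 → (w j → u j))
    (near : ∀ j, 9 ≤ j ∧ j < 13 → (w j ↔ ¬ u j)) {j : ℕ} (hj3 : 3 ≤ j) (hj : j < 13) :
    w j → w (j + 1) → w (j + 5) → w (j + 6) → False := by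
  have n9 := near 9 (by omega)
  have n10 := near 10 (by omega)
  have n11 := near 11 (by omega)
  have n12 := near 12 (by omega)
  obtain ⟨f2, fl, fr, f4⟩ := hu
  clear near
  interval_cases j <;> grind

/-- The forbidden patterns are local: a new one would have to touch the exchanged block, which the
finite checks exclude. This is what makes the span of the tilings invariant under the Hamiltonian.
-/
theorem IsTiling.isTiling_toggle (hL : 30 ≤ L) {X : Config L} (hX : IsTiling X) {x : Fin L}
    (h : IsDimer X x ∨ IsMonomerPair X x) : IsTiling (toggle x X) := by
  obtain ⟨b, rfl⟩ := exists_ringShift_eq x (show 9 ≤ L by omega)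
  obtain ⟨u, hu⟩ : ∃ u : ℕ → Prop, ∀ j, u j ↔ X (ringShift b j) = 1 := ⟨_, fun _ => Iff.rfl⟩
  have hau : AvoidsPatterns u := by
    constructor <;> intro i
    · simpa only [hu, ringShift_ringShift] using hX.no_two (ringShift b i)
    · simpa only [hu, ringShift_ringShift] using hX.no_left (ringShift b i)
    · simpa only [hu, ringShift_ringShift] using hX.no_right (ringShift b i)
    · simpa only [hu, ringShift_ringShift] using hX.no_four (ringShift b i)
  have hx : (¬ u 9 ∧ u 10 ∧ u 11 ∧ ¬ u 12) ∨ (u 9 ∧ ¬ u 10 ∧ ¬ u 11 ∧ u 12) := by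
    simpa only [hu, IsDimer, IsMonomerPair, ringShift_ringShift, Ne] using h
  obtain ⟨w, hw⟩ : ∃ w : ℕ → Prop, ∀ j, w j ↔ toggle (ringShift b 9) X (ringShift b j) = 1 :=
    ⟨_, fun _ => Iff.rfl⟩
  have hwu : ∀ j, j < L + 9 → (w j ↔ if 9 ≤ j ∧ j < 13 then ¬ u j else u j) := fun j hj => by
    by_cases hjL : j < L
    · rw [hw, toggle_ringShift_eq_one b X (by omega) hjL (by omega)]
      simp only [hu, Ne]
    · obtain ⟨m, rfl⟩ := Nat.exists_eq_add_of_le' (not_lt.1 hjL)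
      rw [hw, ringShift_add_self, toggle_ringShift_eq_one b X (by omega) (by omega) (by omega),
        if_neg (by omega), if_neg (by omega), hu, ringShift_add_self]
  have far : ∀ j, j < L + 9 → ¬ (9 ≤ j ∧ j < 13) → (w j → u j) := fun j hj hn => by
    rw [hwu j hj, if_neg hn]; exact id
  have near : ∀ j, 9 ≤ j ∧ j < 13 → (w j ↔ ¬ u j) := fun j hj => by
    rw [hwu j (by omega), if_pos hj]
  -- Counting starts from 3 to L + 2 makes every window end before L + 9, where the block reappears
  -- after one turn; from start 13 onwards a window misses the block altogether.
  have hsplit : ∀ y : Fin L, ∃ j, 3 ≤ j ∧ j < L + 3 ∧ y = ringShift b j := fun y => by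
    obtain ⟨j, hj, rfl⟩ := exists_eq_ringShift (ringShift b 3) y
    exact ⟨3 + j, by omega, by omega, ringShift_ringShift _ _ _⟩
  clear hwu
  have far' : ∀ j, j < 9 ∨ 13 ≤ j ∧ j < 20 → (w j → u j) := fun j hj =>
    far j (by omega) (by omega)
  constructor <;> intro y <;> obtain ⟨j, hj3, hjL, rfl⟩ := hsplit y <;>
    simp only [ringShift_ringShift, ← hw] <;> by_cases hj : j < 13
  · exact hau.no_two_of_exchange hx far' near hj3 hj
  · exact fun h0 h2 => hau.no_two j (far _ (by omega) (by omega) h0)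
      (far _ (by omega) (by omega) h2)
  · exact hau.no_left_of_exchange hx far' near hj3 hj
  · exact fun h0 h1 h4 => hau.no_left j (far _ (by omega) (by omega) h0)
      (far _ (by omega) (by omega) h1) (far _ (by omega) (by omega) h4)
  · exact hau.no_right_of_exchange hx far' near hj3 hj
  · exact fun h0 h3 h4 => hau.no_right j (far _ (by omega) (by omega) h0)
      (far _ (by omega) (by omega) h3) (far _ (by omega) (by omega) h4)
  · exact hau.no_four_of_exchange hx far' near hj3 hj
  · exact fun h0 h1 h5 h6 => hau.no_four j (far _ (by omega) (by omega) h0)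
      (far _ (by omega) (by omega) h1) (far _ (by omega) (by omega) h5)
      (far _ (by omega) (by omega) h6)

end Moves

/-! ### The Hamiltonian on tilings, and its quadratic form -/

section Action

variable {L : ℕ}

/-- Empties the block `x, …, x + 3`. -/
def clearBlock (x : Fin L) (X : Config L) : Config L := fun z =>
  if z = x ∨ z = ringShift x 1 ∨ z = ringShift x 2 ∨ z = ringShift x 3 then 0 else X z

theorem clearBlock_apply {x : Fin L} {X : Config L} {k : ℕ} (hk : k < 4) :
    clearBlock x X (ringShift x k) = 0 := by
  unfold clearBlock
  rw [if_pos]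
  interval_cases k <;> simp [ringShift_zero]

theorem IsDimer.update_eq_clearBlock {X : Config L} {x : Fin L} (h : IsDimer X x) :
    Function.update (Function.update X (ringShift x 1) 0) (ringShift x 2) 0 = clearBlock x X := by
  obtain ⟨h0, -, -, h3⟩ := h
  rw [fin_two_ne_one] at h0 h3
  funext z
  simp only [Function.update_apply, clearBlock]
  by_cases e2 : z = ringShift x 2
  · simp [e2]
  by_cases e1 : z = ringShift x 1
  · simp [e1]
  by_cases e3 : z = ringShift x 3
  · simp [e3, h3]
  by_cases e0 : z = x
  · simp [e0, h0]
  simp [e0, e1, e2, e3]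

theorem IsMonomerPair.update_eq_clearBlock {X : Config L} {x : Fin L} (h : IsMonomerPair X x) :
    Function.update (Function.update X x 0) (ringShift x 3) 0 = clearBlock x X := by
  obtain ⟨-, h1, h2, -⟩ := h
  rw [fin_two_ne_one] at h1 h2
  funext z
  simp only [Function.update_apply, clearBlock]
  by_cases e2 : z = ringShift x 2
  · simp [e2, h2]
  by_cases e1 : z = ringShift x 1
  · simp [e1, h1]
  by_cases e3 : z = ringShift x 3
  · simp [e3]
  by_cases e0 : z = x
  · simp [e0]
  simp [e0, e1, e2, e3]

theorem IsDimer.update_clearBlock (hL : 4 ≤ L) {X : Config L} {x : Fin L} (h : IsDimer X x) :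
    Function.update (Function.update (clearBlock x X) (ringShift x 1) 1) (ringShift x 2) 1 = X := by
  obtain ⟨h0, h1, h2, h3⟩ := h
  rw [fin_two_ne_one] at h0 h3
  have n1 := (ringShift_ne_self (x := x) (i := 1) hL (by omega) (by omega)).symm
  have n2 := (ringShift_ne_self (x := x) (i := 2) hL (by omega) (by omega)).symm
  have n31 := ringShift_ne (x := x) (i := 3) (j := 1) hL (by omega) (by omega) (by omega)
  have n32 := ringShift_ne (x := x) (i := 3) (j := 2) hL (by omega) (by omega) (by omega)
  funext z
  simp only [Function.update_apply, clearBlock]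
  by_cases e2 : z = ringShift x 2
  · simp [e2, h2]
  by_cases e1 : z = ringShift x 1
  · simp [e1, h1]
  by_cases e3 : z = ringShift x 3
  · simp [e3, h3, n31, n32]
  by_cases e0 : z = x
  · simp [e0, h0, n1, n2]
  simp [e0, e1, e2, e3]

theorem IsMonomerPair.update_clearBlock (hL : 4 ≤ L) {X : Config L} {x : Fin L}
    (h : IsMonomerPair X x) :
    Function.update (Function.update (clearBlock x X) x 1) (ringShift x 3) 1 = X := by
  obtain ⟨h0, h1, h2, h3⟩ := h
  rw [fin_two_ne_one] at h1 h2
  have n1 := ringShift_ne_self (x := x) (i := 1) hL (by omega) (by omega)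
  have n2 := ringShift_ne_self (x := x) (i := 2) hL (by omega) (by omega)
  have n13 := ringShift_ne (x := x) (i := 1) (j := 3) hL (by omega) (by omega) (by omega)
  have n23 := ringShift_ne (x := x) (i := 2) (j := 3) hL (by omega) (by omega) (by omega)
  funext z
  simp only [Function.update_apply, clearBlock]
  by_cases e2 : z = ringShift x 2
  · simp [e2, h2, n2, n23]
  by_cases e1 : z = ringShift x 1
  · simp [e1, h1, n1, n13]
  by_cases e3 : z = ringShift x 3
  · simp [e3, h3]
  by_cases e0 : z = x
  · simp [e0, h0]
  simp [e0, e1, e2, e3]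

theorem clearBlock_toggle (x : Fin L) (X : Config L) :
    clearBlock x (toggle x X) = clearBlock x X := by
  funext z
  unfold clearBlock toggle
  split_ifs <;> rfl

/-- Both 0110 and 1001 are sent by q_x to the same emptied block, so the amplitude there compares
`v` at the two ends of an exchange. -/
theorem IsDimer.dipole_mulVec_clearBlock (hL : 4 ≤ L) (lam : ℂ) (v : Config L → ℂ) {X : Config L}
    {x : Fin L} (h : IsDimer X x) :
    (dipole lam x).mulVec v (clearBlock x X) = v X - lam * v (toggle x X) := by
  have h0 := clearBlock_apply (x := x) (X := X) (k := 0) (by omega)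
  rw [ringShift_zero] at h0
  rw [dipole_mulVec hL, if_pos ⟨clearBlock_apply (by omega), clearBlock_apply (by omega)⟩,
    if_pos ⟨h0, clearBlock_apply (by omega)⟩, h.update_clearBlock hL,
    ← clearBlock_toggle x X, h.isMonomerPair_toggle.update_clearBlock hL]

theorem IsMonomerPair.dipole_mulVec_clearBlock (hL : 4 ≤ L) (lam : ℂ) (v : Config L → ℂ)
    {X : Config L} {x : Fin L} (h : IsMonomerPair X x) :
    (dipole lam x).mulVec v (clearBlock x X) = v (toggle x X) - lam * v X := by
  rw [← clearBlock_toggle x X, h.isDimer_toggle.dipole_mulVec_clearBlock hL, toggle_toggle]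

/-- Without particles at distance two, an occupied middle pair forces both end sites of the block to
be empty, and conversely; the two terms of q_x^* therefore see exactly the dimers and the monomer
pairs. -/
theorem dipole_sq_mulVec (hL : 4 ≤ L) (lam : ℂ) (v : Config L → ℂ) {X : Config L}
    (hX : ∀ y, X y = 1 → X (ringShift y 2) = 1 → False) (x : Fin L) :
    ((dipole lam x).conjTranspose * dipole lam x).mulVec v X =
      (if IsDimer X x then v X - lam * v (toggle x X) else 0) +
      (if IsMonomerPair X x then star lam * (lam * v X - v (toggle x X)) else 0) := by
  have hx1 := hX (ringShift x 1)
  rw [ringShift_ringShift] at hx1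
  have c1 : X (ringShift x 1) = 1 ∧ X (ringShift x 2) = 1 ↔ IsDimer X x :=
    ⟨fun h => ⟨fun h' => hX x h' h.2, h.1, h.2, fun h' => hx1 h.1 h'⟩, fun h => ⟨h.2.1, h.2.2.1⟩⟩
  have c2 : X x = 1 ∧ X (ringShift x 3) = 1 ↔ IsMonomerPair X x :=
    ⟨fun h => ⟨h.1, fun h' => hx1 h' h.2, fun h' => hX x h.1 h', h.2⟩, fun h => ⟨h.1, h.2.2.2⟩⟩
  rw [← Matrix.mulVec_mulVec, dipole_conjTranspose_mulVec hL]
  simp only [c1, c2]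
  rw [sub_eq_add_neg]
  congr 1
  · split_ifs with h
    · rw [h.update_eq_clearBlock, h.dipole_mulVec_clearBlock hL]
    · rfl
  · split_ifs with h
    · rw [h.update_eq_clearBlock, h.dipole_mulVec_clearBlock hL]
      ring
    · simp

theorem periodicHamiltonian_mulVec (κ : ℝ) (lam : ℂ) (v : Config L → ℂ) (X : Config L) :
    (periodicHamiltonian L κ lam).mulVec v X =
      ∑ x, ((if X x = 1 ∧ X (ringShift x 2) = 1 then v X else 0) +
        κ * ((dipole lam x).conjTranspose * dipole lam x).mulVec v X) := by
  simp only [periodicHamiltonian, Matrix.sum_mulVec, Matrix.add_mulVec, Matrix.smul_mulVec,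
    Finset.sum_apply, Pi.add_apply, Pi.smul_apply, smul_eq_mul, number_mul_number_mulVec]

theorem IsTiling.periodicHamiltonian_mulVec (hL : 4 ≤ L) (κ : ℝ) (lam : ℂ) (v : Config L → ℂ)
    {X : Config L} (hX : IsTiling X) :
    (periodicHamiltonian L κ lam).mulVec v X =
      κ * ∑ x, ((if IsDimer X x then v X - lam * v (toggle x X) else 0) +
        (if IsMonomerPair X x then star lam * (lam * v X - v (toggle x X)) else 0)) := by
  rw [Haldane.periodicHamiltonian_mulVec, Finset.mul_sum]
  refine Finset.sum_congr rfl fun x _ => ?_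
  rw [if_neg (fun h => hX.no_two x h.1 h.2), zero_add, dipole_sq_mulVec hL lam v hX.no_two]

theorem isHermitian_periodicHamiltonian (κ : ℝ) (lam : ℂ) :
    (periodicHamiltonian L κ lam).IsHermitian := by
  unfold periodicHamiltonian
  rw [Matrix.IsHermitian, Matrix.conjTranspose_sum]
  refine Finset.sum_congr rfl fun x _ => ?_
  have hn : (number x * number (ringShift x 2)).conjTranspose =
      number x * number (ringShift x 2) := by
    have hd : ∀ y : Fin L, number y = Matrix.diagonal fun X => if X y = 1 then 1 else 0 := by
      intro y
      refine Matrix.ext_of_mulVec_single fun X => ?_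
      funext Z
      rw [number_mulVec, Matrix.mulVec_diagonal]
      simp
    rw [hd, hd, Matrix.diagonal_mul_diagonal, Matrix.diagonal_conjTranspose]
    congr 1
    funext X
    by_cases h1 : X x = 1 <;> by_cases h2 : X (ringShift x 2) = 1 <;> simp [h1, h2]
  rw [Matrix.conjTranspose_add, Matrix.conjTranspose_smul, hn, Matrix.conjTranspose_mul,
    Matrix.conjTranspose_conjTranspose]
  simp

/-- The expectation of `∑ n_x n_{x+2}` in the vector `v`. -/
noncomputable def electrostaticEnergy (v : Config L → ℂ) : ℝ :=
  ∑ x, ∑ X : Config L, if X x = 1 ∧ X (ringShift x 2) = 1 then ‖v X‖ ^ 2 else 0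

/-- The contribution to the expectation of `∑ q_x^* q_x` in the vector `v` of the configurations
with a free dimer. -/
noncomputable def dimerEnergy (lam : ℂ) (v : Config L → ℂ) : ℝ :=
  ∑ x, ∑ X : Config L, if IsDimer X x then ‖v X - lam * v (toggle x X)‖ ^ 2 else 0

theorem star_dotProduct_self {ι : Type*} [Fintype ι] (v : ι → ℂ) :
    star v ⬝ᵥ v = ((∑ i, ‖v i‖ ^ 2 : ℝ) : ℂ) := by
  simp only [dotProduct, Pi.star_apply, RCLike.star_def, Complex.conj_mul']
  push_cast
  rfl

theorem star_dotProduct_periodicHamiltonian (κ : ℝ) (lam : ℂ) (v : Config L → ℂ) :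
    star v ⬝ᵥ (periodicHamiltonian L κ lam).mulVec v =
      ((electrostaticEnergy v + κ * ∑ x, ∑ Z, ‖(dipole lam x).mulVec v Z‖ ^ 2 : ℝ) : ℂ) := by
  have hd : ∀ x : Fin L, star v ⬝ᵥ ((dipole lam x).conjTranspose * dipole lam x).mulVec v =
      ((∑ Z, ‖(dipole lam x).mulVec v Z‖ ^ 2 : ℝ) : ℂ) := fun x => by
    rw [← star_dotProduct_self, ← Matrix.mulVec_mulVec, Matrix.dotProduct_mulVec,
      ← Matrix.star_mulVec]
  have hn : ∀ x : Fin L, star v ⬝ᵥ (number x * number (ringShift x 2)).mulVec v =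
      ((∑ X : Config L, if X x = 1 ∧ X (ringShift x 2) = 1 then ‖v X‖ ^ 2 else 0 : ℝ) : ℂ) := by
    intro x
    simp only [dotProduct, number_mul_number_mulVec, Pi.star_apply]
    push_cast
    refine Finset.sum_congr rfl fun X _ => ?_
    split_ifs
    · rw [RCLike.star_def, Complex.conj_mul', Complex.ofReal_pow]
    · simp
  simp only [periodicHamiltonian, Matrix.sum_mulVec, Matrix.add_mulVec, Matrix.smul_mulVec,
    dotProduct_sum, dotProduct_add, dotProduct_smul, hd, hn, electrostaticEnergy, smul_eq_mul,
    Finset.sum_add_distrib, ← Finset.mul_sum]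
  push_cast
  rfl

/-- Keep only those Z that arise by emptying a dimer block; distinct dimer configurations give
distinct Z. -/
theorem dimerEnergy_le (hL : 4 ≤ L) (lam : ℂ) (v : Config L → ℂ) :
    dimerEnergy lam v ≤ ∑ x, ∑ Z, ‖(dipole lam x).mulVec v Z‖ ^ 2 := by
  refine Finset.sum_le_sum fun x _ => ?_
  rw [← Finset.sum_filter]
  have hinj : Set.InjOn (clearBlock x)
      (Finset.univ.filter fun X : Config L => IsDimer X x : Finset (Config L)) := by
    intro X hX Y hY hXY
    have hX' : IsDimer X x := by simpa using hX
    have hY' : IsDimer Y x := by simpa using hY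
    rw [← hX'.update_clearBlock hL, hXY, hY'.update_clearBlock hL]
  calc _ = ∑ X ∈ Finset.univ.filter (fun X : Config L => IsDimer X x),
        ‖(dipole lam x).mulVec v (clearBlock x X)‖ ^ 2 :=
        Finset.sum_congr rfl fun X hX => by
          rw [IsDimer.dipole_mulVec_clearBlock hL lam v (by simpa using hX)]
    _ = ∑ Z ∈ (Finset.univ.filter fun X : Config L => IsDimer X x).image (clearBlock x),
        ‖(dipole lam x).mulVec v Z‖ ^ 2 :=
        (Finset.sum_image (f := fun Z => ‖(dipole lam x).mulVec v Z‖ ^ 2) hinj).symm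
    _ ≤ _ := Finset.sum_le_sum_of_subset_of_nonneg (Finset.subset_univ _)
        fun _ _ _ => by positivity

end Action
-- Energy bound off the tilings
section Complement

variable {L : ℕ}

theorem bijective_ringShift (k : ℕ) : Function.Bijective fun x : Fin L => ringShift x k := by
  refine Finite.injective_iff_bijective.1 fun x y h => ?_
  obtain ⟨j, hj, rfl⟩ := exists_eq_ringShift x y
  have h' : ringShift (ringShift x k) 0 = ringShift (ringShift x k) j := by
    rw [ringShift_zero, ringShift_ringShift, add_comm, ← ringShift_ringShift]
    exact h
  rw [ringShift_inj _ x.pos hj] at h'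
  rw [← h', ringShift_zero]

theorem bijective_toggle (x : Fin L) : Function.Bijective (toggle x) :=
  (show Function.Involutive (toggle x) from toggle_toggle x).bijective

/-- Transport of energy along exchanges: shifts and exchanges are bijective, so no target term is
counted twice. -/
theorem sum_ite_comp_le (k : ℕ) (e : Fin L → Config L → Config L)
    (he : ∀ x, Function.Bijective (e x)) (G : Fin L → Config L → ℝ) (hG : ∀ x X, 0 ≤ G x X)
    (P R : Fin L → Config L → Prop)
    [∀ x X, Decidable (P x X)] [∀ x X, Decidable (R x X)]
    (h : ∀ x X, P x X → R (ringShift x k) (e x X)) :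
    ∑ x, ∑ X, (if P x X then G (ringShift x k) (e x X) else 0) ≤
      ∑ x, ∑ X, if R x X then G x X else 0 := by
  rw [← (bijective_ringShift k).sum_comp fun x => ∑ X, if R x X then G x X else 0]
  refine Finset.sum_le_sum fun x _ => ?_
  rw [← (he x).sum_comp fun X => if R (ringShift x k) X then G (ringShift x k) X else 0]
  refine Finset.sum_le_sum fun X _ => ?_
  by_cases hP : P x X
  · rw [if_pos hP, if_pos (h x X hP)]
  · rw [if_neg hP]
    split_ifs
    · exact hG _ _
    · exact le_rfl

/-- Cauchy–Schwarz for a = (a - λb) + λb. It serves a configuration one exchange away from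
electrostatic energy. -/
theorem norm_sq_le_two_terms {κ : ℝ} (hκ : 0 < κ) (lam a b : ℂ) :
    ‖a‖ ^ 2 ≤ (1 / κ + ‖lam‖ ^ 2) * (κ * ‖a - lam * b‖ ^ 2 + ‖b‖ ^ 2) := by
  have h : ‖a‖ ≤ ‖a - lam * b‖ + ‖lam‖ * ‖b‖ := by
    rw [← norm_mul]
    simpa using norm_add_le (a - lam * b) (lam * b)
  have h2 : ‖a‖ ^ 2 ≤ (‖a - lam * b‖ + ‖lam‖ * ‖b‖) ^ 2 := by gcongr
  generalize ‖a - lam * b‖ = s at *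
  have e : (1 / κ + ‖lam‖ ^ 2) * (κ * s ^ 2 + ‖b‖ ^ 2) - (s + ‖lam‖ * ‖b‖) ^ 2 =
      (‖b‖ - κ * ‖lam‖ * s) ^ 2 / κ := by
    field_simp
    ring
  have : 0 ≤ (‖b‖ - κ * ‖lam‖ * s) ^ 2 / κ := by positivity
  linarith

/-- Cauchy–Schwarz for a = (a - b) - (c - b) + c. The factor λ is absorbed into `b`, which is common
to both exchanges, so the constant does not depend on λ. -/
theorem norm_sq_le_three_terms {κ : ℝ} (hκ : 0 < κ) (a b c : ℂ) :
    ‖a‖ ^ 2 ≤ (2 / κ + 1) * (κ * ‖a - b‖ ^ 2 + κ * ‖c - b‖ ^ 2 + ‖c‖ ^ 2) := by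
  have h : ‖a‖ ≤ ‖a - b‖ + ‖c - b‖ + ‖c‖ := by
    have h1 := norm_add_le (a - b - (c - b)) c
    have h2 := norm_sub_le (a - b) (c - b)
    rw [show a - b - (c - b) + c = a by ring] at h1
    linarith
  have h2 : ‖a‖ ^ 2 ≤ (‖a - b‖ + ‖c - b‖ + ‖c‖) ^ 2 := by gcongr
  generalize ‖a - b‖ = s at *
  generalize ‖c - b‖ = t at *
  generalize ‖c‖ = u at *
  have e : (2 / κ + 1) * (κ * s ^ 2 + κ * t ^ 2 + u ^ 2) - (s + t + u) ^ 2 =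
      (s - t) ^ 2 + ((u - κ * s) ^ 2 + (u - κ * t) ^ 2) / κ := by
    field_simp
    ring
  have : 0 ≤ (s - t) ^ 2 + ((u - κ * s) ^ 2 + (u - κ * t) ^ 2) / κ := by positivity
  linarith

/-- No two occupied sites of `X` are at distance two. -/
def NoTwo (X : Config L) : Prop := ∀ y, X y = 1 → X (ringShift y 2) = 1 → False

instance (X : Config L) : Decidable (NoTwo X) := by
  unfold NoTwo; infer_instance

theorem NoTwo.isDimer {X : Config L} (hX : NoTwo X) {y : Fin L}
    (h0 : X (ringShift y 1) = 1) (h1 : X (ringShift y 2) = 1) : IsDimer X y := by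
  refine ⟨fun h => hX y h h1, h0, h1, fun h => hX (ringShift y 1) h0 ?_⟩
  rwa [ringShift_ringShift]

theorem isTiling_or_exists_pattern (hL : 30 ≤ L) (X : Config L) :
    IsTiling X ∨ ∃ x, (X x = 1 ∧ X (ringShift x 2) = 1) ∨
      (IsDimer X x ∧ X (ringShift x 5) = 1) ∨
      (IsDimer X (ringShift x 2) ∧ X x = 1) ∨
      (NoTwo X ∧ IsDimer X x ∧ X (ringShift x 6) = 1 ∧ X (ringShift x 7) = 1) := by
  by_cases h2 : NoTwo X
  swap
  · unfold NoTwo at h2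
    push Not at h2
    obtain ⟨y, hy⟩ := h2
    exact .inr ⟨y, .inl ⟨hy.1, hy.2.1⟩⟩
  by_cases hx : IsTiling X
  · exact .inl hx
  refine .inr ?_
  by_contra! hn
  refine hx ⟨h2, fun y h0 h1 h4 => ?_, fun y h0 h3 h4 => ?_, fun y h0 h1 h5 h6 => ?_⟩
  · obtain ⟨z, rfl⟩ := exists_ringShift_eq y (show 1 ≤ L by omega)
    rw [ringShift_ringShift] at *
    exact (hn z).2.1 (h2.isDimer h0 h1) h4
  · refine (hn y).2.2.1 (h2.isDimer ?_ ?_) h0 <;> rwa [ringShift_ringShift]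
  · obtain ⟨z, rfl⟩ := exists_ringShift_eq y (show 1 ≤ L by omega)
    simp only [ringShift_ringShift] at h1 h5 h6
    exact (hn z).2.2.2 h2 (h2.isDimer h0 h1) h5 h6

theorem toggle_apply_far (x : Fin L) (X : Config L) {i j : ℕ} (hi : i + 3 < L + j)
    (hiL : i < L) (hj : j < L) (hij : ¬ (i ≤ j ∧ j < i + 4)) :
    toggle (ringShift x i) X (ringShift x j) = 1 ↔ X (ringShift x j) = 1 := by
  rw [toggle_ringShift_eq_one x X hiL hj (by omega), if_neg hij]

/-- Each defect of a non-tiling leads to two particles at distance two: at once, after splitting a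
dimer that has a particle too close to its right or left, or, for two dimers too close together,
after splitting the left one and merging its right monomer with the first particle of the other. The
pointwise bounds are summed over all configurations and positions. -/
theorem sum_norm_sq_le (hL : 30 ≤ L) {κ : ℝ} (hκ : 0 < κ) (lam : ℂ) (v : Config L → ℂ)
    (hv : ∀ X, IsTiling X → v X = 0) :
    ∑ X, ‖v X‖ ^ 2 ≤ (2 + 4 / κ + 2 * ‖lam‖ ^ 2) *
      (electrostaticEnergy v + κ * dimerEnergy lam v) := by
  set N : Fin L → Config L → ℝ := fun _ X => ‖v X‖ ^ 2
  set D : Fin L → Config L → ℝ := fun x X => ‖v X - lam * v (toggle x X)‖ ^ 2 with hD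
  have hN0 : ∀ x X, 0 ≤ N x X := fun _ _ => by positivity
  have hD0 : ∀ x X, 0 ≤ D x X := fun _ _ => by positivity
  set C : ℝ := 1 / κ + ‖lam‖ ^ 2
  set C' : ℝ := 2 / κ + 1
  have hC : 0 < C := by positivity
  have hC' : 0 < C' := by positivity
  set R : Fin L → Config L → Prop := fun x X => X x = 1 ∧ X (ringShift x 2) = 1
  set PL : Fin L → Config L → Prop := fun x X => IsDimer X x ∧ X (ringShift x 5) = 1
  set PR : Fin L → Config L → Prop := fun x X => IsDimer X (ringShift x 2) ∧ X x = 1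
  set PD : Fin L → Config L → Prop := fun x X =>
    NoTwo X ∧ IsDimer X x ∧ X (ringShift x 6) = 1 ∧ X (ringShift x 7) = 1
  set W : Fin L → Config L → Config L := fun x X => toggle (ringShift x 3) (toggle x X)
  have z0 : ∀ x : Fin L, toggle x = toggle (ringShift x 0) := fun x => by rw [ringShift_zero]
  -- On the sites x, …, x + 7 the path is 01100011 → 10010011 → 10001101, which ends with particles
  -- at x + 5 and x + 7.
  have hW : ∀ x X, PD x X → IsDimer (W x X) (ringShift x 3) ∧
      W x X (ringShift x 5) = 1 ∧ W x X (ringShift x 7) = 1 := by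
    rintro x X ⟨h2, hd, h6, h7⟩
    have h4 : X (ringShift x 4) ≠ 1 := fun h => h2 _ h (by rwa [ringShift_ringShift])
    have h5 : X (ringShift x 5) ≠ 1 := fun h => h2 _ h (by rwa [ringShift_ringShift])
    have m : IsMonomerPair (toggle x X) (ringShift x 3) := by
      have f : ∀ j, 4 ≤ j → j < 8 →
          (toggle x X (ringShift x j) = 1 ↔ X (ringShift x j) = 1) := fun j h1 h2 => by
        rw [z0 x]; exact toggle_apply_far x X (by omega) (by omega) (by omega) (by omega)
      refine ⟨hd.isMonomerPair_toggle.2.2.2, ?_, ?_, ?_⟩ <;> rw [ringShift_ringShift]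
      · rw [Ne, f 4 (by omega) (by omega)]; exact h4
      · rw [Ne, f 5 (by omega) (by omega)]; exact h5
      · rw [f 6 (by omega) (by omega)]; exact h6
    have hd' := m.isDimer_toggle
    refine ⟨hd', ?_, ?_⟩
    · have := hd'.2.2.1
      rwa [ringShift_ringShift] at this
    · rw [toggle_apply_far _ _ (by omega) (by omega) (by omega) (by omega), z0 x,
        toggle_apply_far _ _ (by omega) (by omega) (by omega) (by omega)]
      exact h7
  have hpt : ∀ X, ‖v X‖ ^ 2 ≤ ∑ x, ((if R x X then N x X else 0) +
      C * (κ * (if PL x X then D x X else 0) + (if PL x X then N x (toggle x X) else 0)) +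
      C * (κ * (if PR x X then D (ringShift x 2) X else 0) +
        (if PR x X then N x (toggle (ringShift x 2) X) else 0)) +
      C' * (κ * (if PD x X then D x X else 0) +
        κ * (if PD x X then D (ringShift x 3) (W x X) else 0) +
        (if PD x X then N x (W x X) else 0))) := by
    intro X
    have i0 : ∀ (p : Prop) [Decidable p] (a : ℝ), 0 ≤ a → 0 ≤ if p then a else 0 := fun p _ a ha => by
      split_ifs
      · exact ha
      · exact le_rfl
    have t1 : ∀ x, 0 ≤ if R x X then N x X else 0 := fun x => i0 _ _ (hN0 x X)
    have t2 : ∀ x, 0 ≤ C * (κ * (if PL x X then D x X else 0) +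
        (if PL x X then N x (toggle x X) else 0)) := fun x => by
      have := i0 (PL x X) _ (hD0 x X)
      have := i0 (PL x X) _ (hN0 x (toggle x X))
      positivity
    have t3 : ∀ x, 0 ≤ C * (κ * (if PR x X then D (ringShift x 2) X else 0) +
        (if PR x X then N x (toggle (ringShift x 2) X) else 0)) := fun x => by
      have := i0 (PR x X) _ (hD0 (ringShift x 2) X)
      have := i0 (PR x X) _ (hN0 x (toggle (ringShift x 2) X))
      positivity
    have t4 : ∀ x, 0 ≤ C' * (κ * (if PD x X then D x X else 0) +
        κ * (if PD x X then D (ringShift x 3) (W x X) else 0) +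
        (if PD x X then N x (W x X) else 0)) := fun x => by
      have := i0 (PD x X) _ (hD0 x X)
      have := i0 (PD x X) _ (hD0 (ringShift x 3) (W x X))
      have := i0 (PD x X) _ (hN0 x (W x X))
      positivity
    have tn := fun x => add_nonneg (add_nonneg (add_nonneg (t1 x) (t2 x)) (t3 x)) (t4 x)
    rcases isTiling_or_exists_pattern hL X with hX | ⟨x, hx⟩
    · rw [hv X hX]
      simpa using Finset.sum_nonneg fun x _ => tn x
    · refine le_trans ?_ (Finset.single_le_sum (fun x _ => tn x) (Finset.mem_univ x))
      have u1 := t1 x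
      have u2 := t2 x
      have u3 := t3 x
      have u4 := t4 x
      rcases hx with hx | hx | hx | hx
      · have : ‖v X‖ ^ 2 = if R x X then N x X else 0 := by rw [if_pos hx]
        linarith
      · have := norm_sq_le_two_terms hκ lam (v X) (v (toggle x X))
        have hx' : PL x X := hx
        simp only [if_pos hx'] at u2 ⊢
        linarith
      · have := norm_sq_le_two_terms hκ lam (v X) (v (toggle (ringShift x 2) X))
        have hx' : PR x X := hx
        simp only [if_pos hx'] at u3 ⊢
        linarith
      · have := norm_sq_le_three_terms hκ (v X) (lam * v (toggle x X)) (v (W x X))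
        have hx' : PD x X := hx
        have e : D (ringShift x 3) (W x X) = ‖v (W x X) - lam * v (toggle x X)‖ ^ 2 := by
          simp only [hD, W, toggle_toggle]
        simp only [if_pos hx', e] at u4 ⊢
        linarith
  have hE : electrostaticEnergy v = ∑ x, ∑ X, if R x X then N x X else 0 := by
    unfold electrostaticEnergy
    refine Finset.sum_congr rfl fun x _ => Finset.sum_congr rfl fun X _ => ?_
    congr
  have hE' : dimerEnergy lam v = ∑ x, ∑ X, if IsDimer X x then D x X else 0 := by
    unfold dimerEnergy
    refine Finset.sum_congr rfl fun x _ => Finset.sum_congr rfl fun X _ => ?_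
    congr
  have sL : ∑ x, ∑ X, (if PL x X then N x (toggle x X) else 0) ≤ electrostaticEnergy v := by
    rw [hE]
    refine sum_ite_comp_le 3 (fun x => toggle x) bijective_toggle N hN0 PL R fun x X h => ⟨?_, ?_⟩
    · exact h.1.isMonomerPair_toggle.2.2.2
    · rw [ringShift_ringShift, z0 x,
        toggle_apply_far _ _ (by omega) (by omega) (by omega) (by omega)]
      exact h.2
  have sR : ∑ x, ∑ X, (if PR x X then N x (toggle (ringShift x 2) X) else 0) ≤
      electrostaticEnergy v := by
    rw [hE]
    refine sum_ite_comp_le 0 (fun x => toggle (ringShift x 2)) (fun x => bijective_toggle _) N hN0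
      PR R fun x X h => ⟨?_, ?_⟩
    · rw [toggle_apply_far _ _ (by omega) (by omega) (by omega) (by omega), ringShift_zero]
      exact h.2
    · rw [ringShift_zero]
      exact h.1.isMonomerPair_toggle.1
  have sD : ∑ x, ∑ X, (if PD x X then N x (W x X) else 0) ≤ electrostaticEnergy v := by
    rw [hE]
    refine sum_ite_comp_le 5 W (fun x => (bijective_toggle _).comp (bijective_toggle _)) N hN0
      PD R fun x X h => ⟨(hW x X h).2.1, ?_⟩
    rw [ringShift_ringShift]
    exact (hW x X h).2.2
  have dL : ∑ x, ∑ X, (if PL x X then D x X else 0) ≤ dimerEnergy lam v := by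
    rw [hE']
    have := sum_ite_comp_le 0 (fun _ X => X) (fun _ => Function.bijective_id) D hD0 PL
      (fun x X => IsDimer X x) fun x X h => by rw [ringShift_zero]; exact h.1
    simpa only [ringShift_zero] using this
  have dR : ∑ x, ∑ X, (if PR x X then D (ringShift x 2) X else 0) ≤ dimerEnergy lam v := by
    rw [hE']
    exact sum_ite_comp_le 2 (fun _ X => X) (fun _ => Function.bijective_id) D hD0 PR
      (fun x X => IsDimer X x) fun x X h => h.1
  -- The two exchange energies of a path fit into a single copy of the dimer energy: the starting
  -- configuration has no particles at distance two, while the final one does.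
  have dD : ∑ x, ∑ X, (if PD x X then D x X else 0) +
      ∑ x, ∑ X, (if PD x X then D (ringShift x 3) (W x X) else 0) ≤ dimerEnergy lam v := by
    have a1 := sum_ite_comp_le 0 (fun _ X => X) (fun _ => Function.bijective_id) D hD0 PD
      (fun x X => IsDimer X x ∧ NoTwo X) fun x X h => by
        rw [ringShift_zero]; exact ⟨h.2.1, h.1⟩
    have a2 := sum_ite_comp_le 3 W (fun x => (bijective_toggle _).comp (bijective_toggle _)) D hD0
      PD (fun x X => IsDimer X x ∧ ¬ NoTwo X) fun x X h =>
        ⟨(hW x X h).1, fun h2 => h2 _ (hW x X h).2.1 (by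
          rw [ringShift_ringShift]; exact (hW x X h).2.2)⟩
    simp only [ringShift_zero] at a1
    refine (add_le_add a1 a2).trans (le_of_eq ?_)
    rw [hE', ← Finset.sum_add_distrib]
    refine Finset.sum_congr rfl fun x _ => ?_
    rw [← Finset.sum_add_distrib]
    refine Finset.sum_congr rfl fun X _ => ?_
    by_cases h1 : IsDimer X x <;> by_cases h2 : NoTwo X <;> simp [h1, h2]
  have htot := Finset.sum_le_sum fun X (_ : X ∈ Finset.univ) => hpt X
  rw [Finset.sum_comm] at htot
  simp only [Finset.sum_add_distrib, ← Finset.mul_sum] at htot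
  rw [← hE] at htot
  refine htot.trans ?_
  set Ee := electrostaticEnergy v
  set Ed := dimerEnergy lam v
  have hEd : 0 ≤ Ed := by
    rw [hE']
    refine Finset.sum_nonneg fun x _ => Finset.sum_nonneg fun X _ => ?_
    split_ifs
    · exact hD0 _ _
    · exact le_rfl
  -- The constant is 1 + 2C + C', one term for each kind of defect.
  calc _ ≤ Ee + C * (κ * Ed + Ee) + C * (κ * Ed + Ee) + C' * (κ * Ed + Ee) := by
        rw [← mul_add κ]
        gcongr
    _ = (2 + 4 / κ + 2 * ‖lam‖ ^ 2) * (Ee + κ * Ed) - κ * Ed := by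
        simp only [C, C']; ring
    _ ≤ _ := sub_le_self _ (by positivity)

end Complement
-- Moves available near a dimer of a tiling
section Tilings

variable {L : ℕ}

theorem IsTiling.avoidsPatterns {X : Config L} (hX : IsTiling X) (b : Fin L) :
    AvoidsPatterns fun j => X (ringShift b j) = 1 := by
  constructor <;> intro i
  · simpa only [ringShift_ringShift] using hX.no_two (ringShift b i)
  · simpa only [ringShift_ringShift] using hX.no_left (ringShift b i)
  · simpa only [ringShift_ringShift] using hX.no_right (ringShift b i)
  · simpa only [ringShift_ringShift] using hX.no_four (ringShift b i)

theorem toggle_nine_eq_one (hL : 30 ≤ L) (b : Fin L) (X : Config L) {k : ℕ}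
    (hk : k < 9 ∨ 13 ≤ k ∧ k < L + 9) :
    toggle (ringShift b 9) X (ringShift b k) = 1 ↔ X (ringShift b k) = 1 := by
  by_cases hkL : k < L
  · rw [toggle_ringShift_eq_one b X (by omega) hkL (by omega), if_neg (by omega)]
  · obtain ⟨m, rfl⟩ := Nat.exists_eq_add_of_le' (not_lt.1 hkL)
    rw [ringShift_add_self, toggle_ringShift_eq_one b X (by omega) (by omega) (by omega),
      if_neg (by omega)]

theorem isDimer_ringShift {X : Config L} {b : Fin L} {j : ℕ} : IsDimer X (ringShift b j) ↔
    X (ringShift b j) ≠ 1 ∧ X (ringShift b (j + 1)) = 1 ∧ X (ringShift b (j + 2)) = 1 ∧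
      X (ringShift b (j + 3)) ≠ 1 := by
  simp only [IsDimer, ringShift_ringShift]

theorem isMonomerPair_ringShift {X : Config L} {b : Fin L} {j : ℕ} :
    IsMonomerPair X (ringShift b j) ↔
    X (ringShift b j) = 1 ∧ X (ringShift b (j + 1)) ≠ 1 ∧ X (ringShift b (j + 2)) ≠ 1 ∧
      X (ringShift b (j + 3)) = 1 := by
  simp only [IsMonomerPair, ringShift_ringShift]

/-- The rate at which the block `x, …, x + 3` is toggled: one for removing a dimer, `r` for
creating it. -/
noncomputable def rate (r : ℝ) (X : Config L) (x : Fin L) : ℝ :=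
  if IsDimer X x then 1 else if IsMonomerPair X x then r else 0

theorem IsDimer.not_isMonomerPair {X : Config L} {x : Fin L} (h : IsDimer X x) :
    ¬ IsMonomerPair X x := fun h' => h.1 h'.1

theorem rate_of_isDimer {X : Config L} {x : Fin L} (r : ℝ) (h : IsDimer X x) : rate r X x = 1 :=
  if_pos h

theorem rate_of_isMonomerPair {X : Config L} {x : Fin L} (r : ℝ) (h : IsMonomerPair X x) :
    rate r X x = r := by
  rw [rate, if_neg (fun h' => h'.not_isMonomerPair h), if_pos h]

theorem rate_eq_zero {X : Config L} {x : Fin L} (r : ℝ) (h1 : ¬ IsDimer X x)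
    (h2 : ¬ IsMonomerPair X x) : rate r X x = 0 := by
  rw [rate, if_neg h1, if_neg h2]

theorem rate_nonneg {r : ℝ} (hr : 0 ≤ r) (X : Config L) (x : Fin L) : 0 ≤ rate r X x := by
  unfold rate
  split_ifs
  · exact zero_le_one
  · exact hr
  · exact le_rfl

theorem toggle_isTiling_of_rate_ne_zero (hL : 30 ≤ L) {r : ℝ} {X : Config L} {x : Fin L}
    (hX : IsTiling X) (h : rate r X x ≠ 0) : IsTiling (toggle x X) := by
  refine hX.isTiling_toggle hL ?_
  by_contra! hn
  exact h (rate_eq_zero r hn.1 hn.2)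

theorem isDimer_toggle_far (hL : 30 ≤ L) (b : Fin L) (X : Config L) {j : ℕ}
    (hj : j < 6 ∨ 13 ≤ j ∧ j < L) :
    (IsDimer (toggle (ringShift b 9) X) (ringShift b j) ↔ IsDimer X (ringShift b j)) ∧
    (IsMonomerPair (toggle (ringShift b 9) X) (ringShift b j) ↔
      IsMonomerPair X (ringShift b j)) := by
  simp only [isDimer_ringShift, isMonomerPair_ringShift, Ne]
  rw [toggle_nine_eq_one hL b X (k := j) (by omega),
    toggle_nine_eq_one hL b X (k := j + 1) (by omega),
    toggle_nine_eq_one hL b X (k := j + 2) (by omega),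
    toggle_nine_eq_one hL b X (k := j + 3) (by omega)]
  exact ⟨Iff.rfl, Iff.rfl⟩

theorem rate_toggle_far (hL : 30 ≤ L) (r : ℝ) (b : Fin L) (X : Config L) {j : ℕ}
    (hj : j < 6 ∨ 13 ≤ j ∧ j < L) :
    rate r (toggle (ringShift b 9) X) (ringShift b j) = rate r X (ringShift b j) := by
  unfold rate
  simp only [isDimer_toggle_far hL b X hj]

/-- The neighbourhood of a dimer of a tiling at the sites `10, 11`, in terms of the occupied
sites `u`, and `w` for the configuration with the dimer removed. -/
structure DimerAt (u w : ℕ → Prop) : Prop where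
  avoids : AvoidsPatterns u
  avoids' : AvoidsPatterns w
  dimer : ¬ u 9 ∧ u 10 ∧ u 11 ∧ ¬ u 12
  monomers : w 9 ∧ ¬ w 10 ∧ ¬ w 11 ∧ w 12
  far : ∀ j, j < 9 ∨ 13 ≤ j ∧ j < 30 → (w j ↔ u j)

theorem IsTiling.dimerAt (hL : 30 ≤ L) {X : Config L} (hX : IsTiling X) {b : Fin L}
    (h : IsDimer X (ringShift b 9)) :
    DimerAt (fun j => X (ringShift b j) = 1)
      (fun j => toggle (ringShift b 9) X (ringShift b j) = 1) where
  avoids := hX.avoidsPatterns b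
  avoids' := (hX.isTiling_toggle hL (.inl h)).avoidsPatterns b
  dimer := isDimer_ringShift.1 h
  monomers := isMonomerPair_ringShift.1 h.isMonomerPair_toggle
  far := fun j hj => toggle_nine_eq_one hL b X (by omega)

/-- Among the blocks overlapping that of the dimer, removing the dimer enables at most two moves,
each merging one of the freed monomers with a particle three sites further out, at 6 or at 15. -/
theorem DimerAt.near {u w : ℕ → Prop} (h : DimerAt u w) {j : ℕ} (hj : 6 ≤ j ∧ j ≤ 12)
    (hj9 : j ≠ 9) :
    ¬ (¬ u j ∧ u (j + 1) ∧ u (j + 2) ∧ ¬ u (j + 3)) ∧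
    ¬ (u j ∧ ¬ u (j + 1) ∧ ¬ u (j + 2) ∧ u (j + 3)) ∧
    ¬ (¬ w j ∧ w (j + 1) ∧ w (j + 2) ∧ ¬ w (j + 3)) ∧
    ((w j ∧ ¬ w (j + 1) ∧ ¬ w (j + 2) ∧ w (j + 3)) ↔ (j = 6 ∧ u 6) ∨ (j = 12 ∧ u 15)) := by
  obtain ⟨⟨a2, al, ar, a4⟩, ⟨b2, bl, br, b4⟩, hd, hm, hf⟩ := h
  obtain ⟨h1, h2⟩ := hj
  interval_cases j <;> grind

theorem DimerAt.middle {u w : ℕ → Prop} (h : DimerAt u w) {j : ℕ}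
    (hj : j = 4 ∨ j = 5 ∨ j = 13 ∨ j = 14) :
    ¬ (¬ u j ∧ u (j + 1) ∧ u (j + 2) ∧ ¬ u (j + 3)) ∧
    ¬ (u j ∧ ¬ u (j + 1) ∧ ¬ u (j + 2) ∧ u (j + 3)) := by
  obtain ⟨⟨a2, al, ar, a4⟩, ⟨b2, bl, br, b4⟩, hd, hm, hf⟩ := h
  rcases hj with rfl | rfl | rfl | rfl <;> grind

theorem DimerAt.right {u w : ℕ → Prop} (h : DimerAt u w) (h15 : u 15) :
    (u 15 ∧ ¬ u 16 ∧ ¬ u 17 ∧ u 18) ↔ u 18 := by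
  obtain ⟨⟨a2, al, ar, a4⟩, ⟨b2, bl, br, b4⟩, hd, hm, hf⟩ := h
  grind

theorem DimerAt.left {u w : ℕ → Prop} (h : DimerAt u w) (h6 : u 6) :
    (u 3 ∧ ¬ u 4 ∧ ¬ u 5 ∧ u 6) ↔ u 3 := by
  obtain ⟨⟨a2, al, ar, a4⟩, ⟨b2, bl, br, b4⟩, hd, hm, hf⟩ := h
  grind

end Tilings
-- Gap of the dimer generator by a gradient estimate
section Generator

variable {L : ℕ}

/-- The length attributed to the transition that removes the dimer at `x`: it is shorter if
no dimer can be created next to it. -/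
noncomputable def weight (c : ℝ) (X : Config L) (x : Fin L) : ℝ :=
  1 - (if X (ringShift x (L - 3)) = 1 then 0 else c) - (if X (ringShift x 6) = 1 then 0 else c)

theorem weight_ringShift (hL : 3 ≤ L) (c : ℝ) (X : Config L) (b : Fin L) (i : ℕ) :
    weight c X (ringShift b (i + 3)) = 1 - (if X (ringShift b i) = 1 then 0 else c) -
      (if X (ringShift b (i + 9)) = 1 then 0 else c) := by
  rw [weight, ringShift_ringShift, ringShift_ringShift,
    show i + 3 + (L - 3) = i + L by omega, ringShift_add_self]

theorem sum_eq_sum_range_ringShift (b : Fin L) (F : Fin L → ℂ) :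
    ∑ y, F y = ∑ j ∈ Finset.range L, F (ringShift b j) := by
  rw [Finset.sum_range fun j => F (ringShift b j)]
  refine (Function.Bijective.sum_comp ?_ F).symm
  refine Finite.injective_iff_bijective.1 fun i j h => ?_
  exact Fin.ext ((ringShift_inj b i.2 j.2).1 h)

theorem weight_toggle_far (hL : 30 ≤ L) (c : ℝ) (X : Config L) (b : Fin L) {j : ℕ}
    (hjL : j < L) (hj : j < 3 ∨ 15 < j) :
    weight c (toggle (ringShift b j) X) (ringShift b 9) = weight c X (ringShift b 9) := by
  have h6 := toggle_ringShift_eq_one b X (j := 6) hjL (by omega) (by omega)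
  have h15 := toggle_ringShift_eq_one b X (j := 15) hjL (by omega) (by omega)
  rw [if_neg (by omega)] at h6 h15
  rw [weight_ringShift (by omega) c X b 6,
    weight_ringShift (by omega) c (toggle (ringShift b j) X) b 6]
  simp only [Nat.reduceAdd, h6, h15]

theorem weight_toggle_right (hL : 30 ≤ L) (c : ℝ) (X : Config L) (b : Fin L) :
    weight c X (ringShift b 9) - weight c (toggle (ringShift b 15) X) (ringShift b 9) =
      if X (ringShift b 15) = 1 then c else -c := by
  have h6 := toggle_ringShift_eq_one b X (j := 6) (show 15 < L by omega) (by omega) (by omega)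
  have h15 := toggle_ringShift_eq_one b X (j := 15) (show 15 < L by omega) (by omega) (by omega)
  rw [if_neg (by omega)] at h6
  rw [if_pos (by omega)] at h15
  rw [weight_ringShift (by omega) c X b 6,
    weight_ringShift (by omega) c (toggle (ringShift b 15) X) b 6]
  simp only [Nat.reduceAdd, h6, h15]
  split_ifs <;> first | contradiction | ring

theorem weight_toggle_left (hL : 30 ≤ L) (c : ℝ) (X : Config L) (b : Fin L) :
    weight c X (ringShift b 9) - weight c (toggle (ringShift b 3) X) (ringShift b 9) =
      if X (ringShift b 6) = 1 then c else -c := by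
  have h6 := toggle_ringShift_eq_one b X (j := 6) (show 3 < L by omega) (by omega) (by omega)
  have h15 := toggle_ringShift_eq_one b X (j := 15) (show 3 < L by omega) (by omega) (by omega)
  rw [if_pos (by omega)] at h6
  rw [if_neg (by omega)] at h15
  rw [weight_ringShift (by omega) c X b 6,
    weight_ringShift (by omega) c (toggle (ringShift b 3) X) b 6]
  simp only [Nat.reduceAdd, h6, h15]
  split_ifs <;> first | contradiction | ring

section Rates

variable {X : Config L} {b : Fin L}

theorem rate_near (hL : 30 ≤ L) (r : ℝ) (hX : IsTiling X) (h : IsDimer X (ringShift b 9)) {j : ℕ}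
    (hj : 6 ≤ j ∧ j ≤ 12) (hj9 : j ≠ 9) : rate r X (ringShift b j) = 0 := by
  have := (hX.dimerAt hL h).near hj hj9
  exact rate_eq_zero r (isDimer_ringShift.not.2 this.1) (isMonomerPair_ringShift.not.2 this.2.1)

theorem rate_middle (hL : 30 ≤ L) (r : ℝ) (hX : IsTiling X) (h : IsDimer X (ringShift b 9))
    {j : ℕ} (hj : j = 4 ∨ j = 5 ∨ j = 13 ∨ j = 14) : rate r X (ringShift b j) = 0 := by
  have := (hX.dimerAt hL h).middle hj
  exact rate_eq_zero r (isDimer_ringShift.not.2 this.1) (isMonomerPair_ringShift.not.2 this.2)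

theorem rate_toggle_near (hL : 30 ≤ L) (r : ℝ) (hX : IsTiling X)
    (h : IsDimer X (ringShift b 9)) {j : ℕ} (hj : 6 ≤ j ∧ j ≤ 12) (hj9 : j ≠ 9) :
    rate r (toggle (ringShift b 9) X) (ringShift b j) =
      if (j = 6 ∧ X (ringShift b 6) = 1) ∨ (j = 12 ∧ X (ringShift b 15) = 1) then r else 0 := by
  have := (hX.dimerAt hL h).near hj hj9
  rw [rate, if_neg (isDimer_ringShift.not.2 this.2.2.1)]
  have h4 := isMonomerPair_ringShift.trans this.2.2.2
  by_cases hm : IsMonomerPair (toggle (ringShift b 9) X) (ringShift b j)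
  · rw [if_pos hm, if_pos (h4.1 hm)]
  · rw [if_neg hm, if_neg fun h' => hm (h4.2 h')]

theorem rate_right (hL : 30 ≤ L) (r : ℝ) (hX : IsTiling X) (h : IsDimer X (ringShift b 9))
    (h15 : X (ringShift b 15) = 1) :
    rate r X (ringShift b 15) = if X (ringShift b 18) = 1 then r else 0 := by
  have h4 := isMonomerPair_ringShift.trans ((hX.dimerAt hL h).right h15)
  rw [rate, if_neg fun h' => h'.1 h15]
  by_cases hm : X (ringShift b 18) = 1
  · rw [if_pos hm, if_pos (h4.2 hm)]
  · rw [if_neg hm, if_neg fun h' => hm (h4.1 h')]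

theorem rate_left (hL : 30 ≤ L) (r : ℝ) (hX : IsTiling X) (h : IsDimer X (ringShift b 9))
    (h6 : X (ringShift b 6) = 1) :
    rate r X (ringShift b 3) = if X (ringShift b 3) = 1 then r else 0 := by
  have h4 := isMonomerPair_ringShift.trans ((hX.dimerAt hL h).left h6)
  rw [rate, if_neg fun h' => (isDimer_ringShift.1 h').2.2.2 h6]
  by_cases hm : X (ringShift b 3) = 1
  · rw [if_pos hm, if_pos (h4.2 hm)]
  · rw [if_neg hm, if_neg fun h' => hm (h4.1 h')]

theorem rate_right_le (r : ℝ) (h15 : X (ringShift b 15) ≠ 1) :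
    rate r X (ringShift b 15) ≤ 1 := by
  have : ¬ IsMonomerPair X (ringShift b 15) := fun h' => h15 h'.1
  unfold rate
  rw [if_neg this]
  split_ifs <;> norm_num

theorem rate_left_le (r : ℝ) (h6 : X (ringShift b 6) ≠ 1) :
    rate r X (ringShift b 3) ≤ 1 := by
  have : ¬ IsMonomerPair X (ringShift b 3) := fun h' => h6 (isMonomerPair_ringShift.1 h').2.2.2
  unfold rate
  rw [if_neg this]
  split_ifs <;> norm_num

end Rates

/-- If the increment of `f` along a dimer removal is maximal relative to the weights, then
the eigenvalue equation at both ends of this transition bounds the eigenvalue from below. -/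
theorem inv_one_add_le_of_isMax (hL : 30 ≤ L) {r : ℝ} (hr : 0 ≤ r) {f : Config L → ℂ} {ν : ℝ}
    (hf : ∀ X, IsTiling X → ν * f X = ∑ y, rate r X y * (f X - f (toggle y X))) {m : ℝ}
    (hm : 0 < m)
    (hmax : ∀ X x, IsTiling X → IsDimer X x →
      ‖f X - f (toggle x X)‖ ≤ m * weight (r / (2 * (1 + r))) X x)
    {X : Config L} {x : Fin L} (hX : IsTiling X) (hx : IsDimer X x)
    (heq : ‖f X - f (toggle x X)‖ = m * weight (r / (2 * (1 + r))) X x) :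
    1 / (1 + r) ≤ ν := by
  obtain ⟨b, rfl⟩ := exists_ringShift_eq x (show 9 ≤ L by omega)
  -- This `c` makes the final local estimate give the same value 1 - 2c = 1/(1 + r) whichever of the
  -- two neighbouring sites are occupied.
  set c := r / (2 * (1 + r)) with hc
  have hc0 : 0 ≤ c := by positivity
  have hcr : 2 * c * (1 + r) = r := by rw [hc]; field_simp
  set Y := toggle (ringShift b 9) X with hYdef
  have hY : IsTiling Y := hX.isTiling_toggle hL (.inl hx)
  set g := f X - f Y with hg
  set w := weight c X (ringShift b 9) with hw
  -- In ν g = ∑ T_j the move at `j` pulls on the gradient `g` with coefficient `A j`, up to an error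
  -- of norm at most `m * B j`. Only `j = 9`, which traverses the edge itself, pulls with no error.
  set A : ℕ → ℝ := fun j =>
    if j = 9 then 1 + r else if 6 ≤ j ∧ j ≤ 12 then 0 else rate r X (ringShift b j) with hA
  set B : ℕ → ℝ := fun j =>
    if j = 9 then 0 else
    if j = 6 then rate r Y (ringShift b 6) * (1 - if X (ringShift b 3) = 1 then 0 else c) else
    if j = 12 then rate r Y (ringShift b 12) * (1 - if X (ringShift b 18) = 1 then 0 else c) else
    if 6 ≤ j ∧ j ≤ 12 then 0 else
    rate r X (ringShift b j) * weight c (toggle (ringShift b j) X) (ringShift b 9) with hB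
  set T : ℕ → ℂ := fun j =>
    rate r X (ringShift b j) * (f X - f (toggle (ringShift b j) X)) -
      rate r Y (ringShift b j) * (f Y - f (toggle (ringShift b j) Y)) with hT
  have hsum : (ν : ℂ) * g = ∑ j ∈ Finset.range L, T j := by
    rw [hg, mul_sub, hf X hX, hf Y hY, sum_eq_sum_range_ringShift b, sum_eq_sum_range_ringShift b,
      ← Finset.sum_sub_distrib]
  have hbound : ∀ j ∈ Finset.range L, ‖(A j : ℂ) * g - T j‖ ≤ m * B j := by
    intro j hj
    rw [Finset.mem_range] at hj
    by_cases hj9 : j = 9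
    · subst hj9
      have e1 : A 9 = 1 + r := by simp [hA]
      have e2 : B 9 = 0 := by simp [hB]
      have e3 : T 9 = (1 + r) * g := by
        simp only [hT]
        rw [rate_of_isDimer r hx, rate_of_isMonomerPair r hx.isMonomerPair_toggle, hYdef,
          toggle_toggle, ← hYdef, hg]
        push_cast
        ring
      rw [e1, e2, e3]
      simp
    by_cases hn : 6 ≤ j ∧ j ≤ 12
    · have e1 : A j = 0 := by simp [hA, hj9, hn]
      have e3 : (A j : ℂ) * g - T j =
          rate r Y (ringShift b j) * (f Y - f (toggle (ringShift b j) Y)) := by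
        simp only [hT]
        rw [e1, rate_near hL r hX hx hn hj9]
        push_cast
        ring
      rw [e3, norm_mul, Complex.norm_real, Real.norm_of_nonneg (rate_nonneg hr _ _)]
      have hrate := rate_toggle_near hL r hX hx hn hj9
      rw [← hYdef] at hrate
      by_cases hz : rate r Y (ringShift b j) = 0
      · have e2 : B j = 0 := by
          simp only [hB]
          rw [if_neg hj9]
          by_cases i1 : j = 6
          · rw [if_pos i1, ← i1, hz, zero_mul]
          by_cases i2 : j = 12
          · rw [if_neg i1, if_pos i2, ← i2, hz, zero_mul]
          · rw [if_neg i1, if_neg i2, if_pos hn]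
        rw [hz, e2]
        simp
      have hU := toggle_isTiling_of_rate_ne_zero hL hY hz
      -- This move exists only after the dimer has been removed. Its increment is controlled by
      -- maximality at the configuration where the new dimer is present; the other freed monomer
      -- then occupies one of the two sites entering the weight there.
      have hYm : IsMonomerPair Y (ringShift b j) := by
        by_contra hno
        have := ((hX.dimerAt hL hx).near hn hj9).2.2.1
        exact hz (rate_eq_zero r (isDimer_ringShift.not.2 this) hno)
      have hb := hmax _ _ hU hYm.isDimer_toggle
      rw [toggle_toggle, norm_sub_rev] at hb
      have hm' := isMonomerPair_ringShift.1 hx.isMonomerPair_toggle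
      rw [← hYdef] at hm'
      have hj' : j = 6 ∨ j = 12 := by
        by_contra! hne
        rw [if_neg (by omega)] at hrate
        exact hz hrate
      rcases hj' with rfl | rfl
      · have e2 : B 6 = rate r Y (ringShift b 6) *
            (1 - if X (ringShift b 3) = 1 then 0 else c) := by simp [hB]
        have k1 : toggle (ringShift b 6) Y (ringShift b 3) = 1 ↔ X (ringShift b 3) = 1 := by
          rw [toggle_ringShift_eq_one b Y (by omega) (by omega) (by omega), if_neg (by omega),
            toggle_nine_eq_one hL b X (by omega)]
        have k2 : toggle (ringShift b 6) Y (ringShift b 12) = 1 := by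
          rw [toggle_ringShift_eq_one b Y (by omega) (by omega) (by omega), if_neg (by omega)]
          exact hm'.2.2.2
        rw [weight_ringShift (by omega) c (toggle (ringShift b 6) Y) b 3] at hb
        simp only [Nat.reduceAdd, k1, k2, if_true, sub_zero] at hb
        rw [e2, mul_left_comm]
        gcongr
        exact rate_nonneg hr _ _
      · have e2 : B 12 = rate r Y (ringShift b 12) *
            (1 - if X (ringShift b 18) = 1 then 0 else c) := by simp [hB]
        have k1 : toggle (ringShift b 12) Y (ringShift b 18) = 1 ↔ X (ringShift b 18) = 1 := by
          rw [toggle_ringShift_eq_one b Y (by omega) (by omega) (by omega), if_neg (by omega),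
            toggle_nine_eq_one hL b X (by omega)]
        have k2 : toggle (ringShift b 12) Y (ringShift b 9) = 1 := by
          rw [toggle_ringShift_eq_one b Y (by omega) (by omega) (by omega), if_neg (by omega)]
          exact hm'.1
        rw [weight_ringShift (by omega) c (toggle (ringShift b 12) Y) b 9] at hb
        simp only [Nat.reduceAdd, k1, k2, if_true, sub_zero] at hb
        rw [e2, mul_left_comm]
        gcongr
        exact rate_nonneg hr _ _
    · have e1 : A j = rate r X (ringShift b j) := by simp [hA, hj9, hn]
      have e2 : B j = rate r X (ringShift b j) *
          weight c (toggle (ringShift b j) X) (ringShift b 9) := by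
        simp only [hB]
        rw [if_neg hj9, if_neg (by omega), if_neg (by omega), if_neg hn]
      have hYr : rate r Y (ringShift b j) = rate r X (ringShift b j) :=
        rate_toggle_far hL r b X (by omega)
      -- A move away from the block has the same rate at both ends of the edge and commutes with the
      -- removal, so what remains is the gradient along the translated edge.
      have e3 : (A j : ℂ) * g - T j = rate r X (ringShift b j) *
          (f (toggle (ringShift b j) X) -
            f (toggle (ringShift b 9) (toggle (ringShift b j) X))) := by
        simp only [hT]
        rw [e1, hYr, hYdef, toggle_comm (ringShift b j), ← hYdef, hg]
        ring
      rw [e3, e2, norm_mul, Complex.norm_real, Real.norm_of_nonneg (rate_nonneg hr _ _)]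
      by_cases hz : rate r X (ringShift b j) = 0
      · simp [hz]
      have hU := toggle_isTiling_of_rate_ne_zero hL hX hz
      have hUd : IsDimer (toggle (ringShift b j) X) (ringShift b 9) := by
        have h9 := isDimer_ringShift.1 hx
        rw [isDimer_ringShift, Ne, Ne]
        have hk : ∀ k, 9 ≤ k → k < 13 →
            (toggle (ringShift b j) X (ringShift b k) = 1 ↔ X (ringShift b k) = 1) := by
          intro k h1 h2
          rw [toggle_ringShift_eq_one b X (j := k) hj (by omega) (by omega), if_neg (by omega)]
        rw [hk _ (by omega) (by omega), hk _ (by omega) (by omega), hk _ (by omega) (by omega),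
          hk _ (by omega) (by omega)]
        exact h9
      rw [mul_left_comm]
      gcongr
      · exact rate_nonneg hr _ _
      · exact hmax _ _ hU hUd
  have hineq : ∑ j ∈ Finset.range L, (A j * w - B j) ≤ ν * w := by
    have h1 : ‖((∑ j ∈ Finset.range L, A j : ℝ) : ℂ) * g - ν * g‖ ≤
        m * ∑ j ∈ Finset.range L, B j := by
      rw [hsum, Complex.ofReal_sum, Finset.sum_mul, ← Finset.sum_sub_distrib, Finset.mul_sum]
      exact norm_sum_le_of_le _ hbound
    rw [← sub_mul, ← Complex.ofReal_sub, norm_mul, Complex.norm_real, heq] at h1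
    have h2 : (∑ j ∈ Finset.range L, A j - ν) * (m * w) ≤ m * ∑ j ∈ Finset.range L, B j :=
      (mul_le_mul_of_nonneg_right (le_abs_self _) (heq ▸ norm_nonneg _)).trans h1
    rw [Finset.sum_sub_distrib, ← Finset.sum_mul]
    have h3 : m * ((∑ j ∈ Finset.range L, A j - ν) * w) ≤ m * ∑ j ∈ Finset.range L, B j := by
      linarith
    have := le_of_mul_le_mul_left h3 hm
    linarith
  -- Outside the overlap a move contributes its rate times the change of the weight, hence nothing
  -- unless it touches site 6 or 15. Of the blocks that do, those starting at 4, 5, 13, 14 have rate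
  -- zero.
  have hreduce : ∑ j ∈ Finset.range L, (A j * w - B j) =
      ∑ j ∈ ({3, 6, 9, 12, 15} : Finset ℕ), (A j * w - B j) := by
    symm
    refine Finset.sum_subset ?_ ?_
    · intro j hj
      simp only [Finset.mem_insert, Finset.mem_singleton] at hj
      rw [Finset.mem_range]
      omega
    · intro j hj hjn
      rw [Finset.mem_range] at hj
      simp only [Finset.mem_insert, Finset.mem_singleton, not_or] at hjn
      obtain ⟨k3, k6, k9, k12, k15⟩ := hjn
      by_cases hn : 6 ≤ j ∧ j ≤ 12
      · simp [hA, hB, k9, k6, k12, hn]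
      · simp only [hA, hB, if_neg k9, if_neg k6, if_neg k12, if_neg hn]
        by_cases hmid : j = 4 ∨ j = 5 ∨ j = 13 ∨ j = 14
        · rw [rate_middle hL r hX hx hmid]; ring
        · rw [weight_toggle_far hL c X b hj (by omega), hw, sub_self]
  have v9 : A 9 * w - B 9 = (1 + r) * w := by simp [hA, hB]
  -- If site 15 is occupied, the newly enabled move costs r(1 - c) when 18 is empty; when 18 is
  -- occupied it costs r, but creating a dimer at 15 regains rc. If site 15 is empty, the only
  -- possible loss comes from removing a dimer there, at rate at most 1.
  have hright : -(if X (ringShift b 15) = 1 then r * (1 - c) else c) ≤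
      (A 12 * w - B 12) + (A 15 * w - B 15) := by
    have q1 : A 12 * w - B 12 = -(rate r Y (ringShift b 12) *
        (1 - if X (ringShift b 18) = 1 then 0 else c)) := by simp [hA, hB]
    have q2 : A 15 * w - B 15 = rate r X (ringShift b 15) *
        (w - weight c (toggle (ringShift b 15) X) (ringShift b 9)) := by simp [hA, hB]; ring
    rw [q1, q2, hw, weight_toggle_right hL, hYdef,
      rate_toggle_near hL r hX hx (by omega) (by omega)]
    by_cases h15 : X (ringShift b 15) = 1
    · rw [rate_right hL r hX hx h15]
      simp only [h15]
      split_ifs <;> linarith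
    · have := rate_right_le r h15
      simp only [h15]
      simp
      nlinarith
  have hleft : -(if X (ringShift b 6) = 1 then r * (1 - c) else c) ≤
      (A 6 * w - B 6) + (A 3 * w - B 3) := by
    have q1 : A 6 * w - B 6 = -(rate r Y (ringShift b 6) *
        (1 - if X (ringShift b 3) = 1 then 0 else c)) := by simp [hA, hB]
    have q2 : A 3 * w - B 3 = rate r X (ringShift b 3) *
        (w - weight c (toggle (ringShift b 3) X) (ringShift b 9)) := by simp [hA, hB]; ring
    rw [q1, q2, hw, weight_toggle_left hL, hYdef,
      rate_toggle_near hL r hX hx (by omega) (by omega)]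
    by_cases h6 : X (ringShift b 6) = 1
    · rw [rate_left hL r hX hx h6]
      simp only [h6]
      split_ifs <;> linarith
    · have := rate_left_le r h6
      simp only [h6]
      simp
      nlinarith
  have hwv : w = 1 - (if X (ringShift b 6) = 1 then 0 else c) -
      (if X (ringShift b 15) = 1 then 0 else c) := weight_ringShift (by omega) c X b 6
  have hc1 : 1 - 2 * c = 1 / (1 + r) := by
    rw [hc]; field_simp; ring
  have hw0 : 0 < w := by
    have : 0 < 1 / (1 + r) := by positivity
    rw [hwv]
    split_ifs <;> linarith
  have hw1 : w ≤ 1 := by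
    rw [hwv]
    split_ifs <;> linarith
  have hfin : 1 / (1 + r) ≤ ν * w := by
    refine le_trans ?_ hineq
    rw [hreduce]
    simp only [Finset.mem_insert, Finset.mem_singleton, Nat.reduceEqDiff, or_self,
      not_false_eq_true, Finset.sum_insert, Finset.sum_singleton]
    rw [v9, ← hc1]
    have : (1 - 2 * c) ≤ (1 + r) * w - (if X (ringShift b 15) = 1 then r * (1 - c) else c) -
        (if X (ringShift b 6) = 1 then r * (1 - c) else c) := by
      rw [hwv]
      split_ifs <;> linarith
    linarith
  have hν : 0 ≤ ν := by
    by_contra! hneg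
    have h1 := mul_neg_of_neg_of_pos hneg hw0
    have h2 : 0 < 1 / (1 + r) := by positivity
    linarith
  exact hfin.trans (mul_le_of_le_one_right hν hw1)

theorem weight_pos {r : ℝ} (hr : 0 ≤ r) (X : Config L) (x : Fin L) :
    0 < weight (r / (2 * (1 + r))) X x := by
  have h1 : 1 - 2 * (r / (2 * (1 + r))) = 1 / (1 + r) := by field_simp; ring
  have h2 : 0 < 1 / (1 + r) := by positivity
  have h3 : 0 ≤ r / (2 * (1 + r)) := by positivity
  unfold weight
  split_ifs <;> linarith

/-- If `f` is constant along all dimer removals, the generator annihilates it. Otherwise the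
weighted increments have a positive maximum over the finitely many transitions, and the maximum
principle applies there. -/
theorem eq_zero_or_inv_one_add_le (hL : 30 ≤ L) {r : ℝ} (hr : 0 ≤ r) {f : Config L → ℂ} {ν : ℝ}
    (hf : ∀ X, IsTiling X → ν * f X = ∑ y, rate r X y * (f X - f (toggle y X))) :
    (∀ X, IsTiling X → f X = 0) ∨ ν = 0 ∨ 1 / (1 + r) ≤ ν := by
  classical
  by_cases hz : ∀ X x, IsTiling X → IsDimer X x → f X = f (toggle x X)
  · have h0 : ∀ X, IsTiling X → (ν : ℂ) * f X = 0 := by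
      intro X hX
      rw [hf X hX]
      refine Finset.sum_eq_zero fun y _ => ?_
      by_cases h1 : IsDimer X y
      · rw [hz X y hX h1, sub_self, mul_zero]
      by_cases h2 : IsMonomerPair X y
      · have := hz _ y (hX.isTiling_toggle hL (.inr h2)) h2.isDimer_toggle
        rw [toggle_toggle] at this
        rw [this, sub_self, mul_zero]
      · rw [rate_eq_zero r h1 h2]
        simp
    by_cases hν : ν = 0
    · exact .inr (.inl hν)
    · exact .inl fun X hX => (mul_eq_zero.1 (h0 X hX)).resolve_left (by exact_mod_cast hν)
  · push Not at hz
    obtain ⟨X₀, x₀, hX₀, hx₀, hne⟩ := hz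
    set S : Finset (Config L × Fin L) :=
      Finset.univ.filter fun p => IsTiling p.1 ∧ IsDimer p.1 p.2
    have hmem : ∀ X x, IsTiling X → IsDimer X x → (X, x) ∈ S := fun X x h1 h2 => by
      simp [S, h1, h2]
    obtain ⟨⟨X, x⟩, hXx, hmax⟩ := Finset.exists_max_image S
      (fun p => ‖f p.1 - f (toggle p.2 p.1)‖ / weight (r / (2 * (1 + r))) p.1 p.2)
      ⟨_, hmem X₀ x₀ hX₀ hx₀⟩
    have hXx' : IsTiling X ∧ IsDimer X x := by simpa [S] using hXx
    refine .inr (.inr (inv_one_add_le_of_isMax hL hr hf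
      (m := ‖f X - f (toggle x X)‖ / weight (r / (2 * (1 + r))) X x) ?_ ?_ hXx'.1 hXx'.2
      (div_mul_cancel₀ _ (weight_pos hr X x).ne').symm))
    · refine lt_of_lt_of_le ?_ (hmax _ (hmem X₀ x₀ hX₀ hx₀))
      exact div_pos (norm_pos_iff.2 (sub_ne_zero.2 hne)) (weight_pos hr X₀ x₀)
    · intro X' x' h1 h2
      rw [← div_le_iff₀ (weight_pos hr X' x')]
      exact hmax _ (hmem X' x' h1 h2)

end Generator
-- From the two invariant subspaces to the spectral gap
section Spectrum

variable {L : ℕ}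

/-- The number of dimers of a tiling. -/
def dimerCount (X : Config L) : ℕ := (Finset.univ.filter fun x => IsDimer X x).card

theorem IsTiling.dimerCount_eq (hL : 30 ≤ L) {X : Config L} (hX : IsTiling X) {x : Fin L}
    (hx : IsDimer X x) : dimerCount X = dimerCount (toggle x X) + 1 := by
  obtain ⟨b, rfl⟩ := exists_ringShift_eq x (show 9 ≤ L by omega)
  have hset : (Finset.univ.filter fun y => IsDimer (toggle (ringShift b 9) X) y) =
      (Finset.univ.filter fun y => IsDimer X y).erase (ringShift b 9) := by
    ext y
    obtain ⟨j, hj, rfl⟩ := exists_eq_ringShift b y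
    simp only [Finset.mem_filter, Finset.mem_univ, true_and, Finset.mem_erase, Ne,
      ringShift_inj b hj (show 9 < L by omega)]
    by_cases h9 : j = 9
    · subst h9
      simpa using fun h => IsDimer.not_isMonomerPair h hx.isMonomerPair_toggle
    by_cases hn : 6 ≤ j ∧ j ≤ 12
    · have := (hX.dimerAt hL hx).near hn h9
      have h1 := isDimer_ringShift.not.2 this.1
      have h2 := isDimer_ringShift.not.2 this.2.2.1
      tauto
    · rw [(isDimer_toggle_far hL b X (by omega)).1]
      tauto
  rw [dimerCount, dimerCount, hset, Finset.card_erase_add_one (by simpa using hx)]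

/-- Since an exchange changes the number of dimers by exactly one, division by λ to that power turns
v(X) - λv(X') into a plain difference, and the monomer-pair term into |λ|² times one. -/
theorem eigenvalue_of_tilings (hL : 30 ≤ L) {κ : ℝ} (hκ : 0 < κ) {lam : ℂ} (hlam : lam ≠ 0)
    {v : Config L → ℂ} {μ : ℝ}
    (hv : ∀ X, IsTiling X → (periodicHamiltonian L κ lam).mulVec v X = μ * v X) :
    (∀ X, IsTiling X → v X = 0) ∨ μ = 0 ∨ κ / (1 + ‖lam‖ ^ 2) ≤ μ := by
  have hκ' : (κ : ℂ) ≠ 0 := by exact_mod_cast hκ.ne'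
  have key : ∀ X : Config L, IsTiling X → ((μ / κ : ℝ) : ℂ) * (v X / lam ^ dimerCount X) =
      ∑ y, rate (‖lam‖ ^ 2) X y * (v X / lam ^ dimerCount X -
        v (toggle y X) / lam ^ dimerCount (toggle y X)) := by
    intro X hX
    have h := hv X hX
    rw [hX.periodicHamiltonian_mulVec (by omega)] at h
    have h' : ((μ / κ : ℝ) : ℂ) * (v X / lam ^ dimerCount X) =
        (μ * v X) / κ / lam ^ dimerCount X := by
      push_cast
      ring
    rw [h', ← h, mul_div_cancel_left₀ _ hκ', Finset.sum_div]
    refine Finset.sum_congr rfl fun y _ => ?_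
    by_cases h1 : IsDimer X y
    · rw [if_pos h1, if_neg h1.not_isMonomerPair, rate_of_isDimer _ h1, hX.dimerCount_eq hL h1]
      have := pow_ne_zero (dimerCount (toggle y X)) hlam
      field_simp
      push_cast
      ring
    by_cases h2 : IsMonomerPair X y
    · have hcount := (hX.isTiling_toggle hL (.inr h2)).dimerCount_eq hL h2.isDimer_toggle
      rw [toggle_toggle] at hcount
      rw [if_neg h1, if_pos h2, rate_of_isMonomerPair _ h2, hcount]
      have := pow_ne_zero (dimerCount X) hlam
      have hn : ((‖lam‖ ^ 2 : ℝ) : ℂ) = star lam * lam := by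
        rw [RCLike.star_def, Complex.conj_mul', Complex.ofReal_pow]
      rw [hn]
      field_simp
      ring
    · rw [if_neg h1, if_neg h2, rate_eq_zero _ h1 h2]
      simp
  rcases eq_zero_or_inv_one_add_le hL (sq_nonneg ‖lam‖)
    (f := fun X => v X / lam ^ dimerCount X) key with h | h | h
  · exact .inl fun X hX => (div_eq_zero_iff.1 (h X hX)).resolve_right (pow_ne_zero _ hlam)
  · exact .inr (.inl ((div_eq_zero_iff.1 h).resolve_right hκ.ne'))
  · refine .inr (.inr ?_)
    rw [le_div_iff₀ hκ] at h
    rwa [div_eq_mul_one_div, mul_comm]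

-- The part `a` of the eigenvector off the tilings is nonzero. Invariance and hermiticity remove the
-- cross terms, so the energy of `a` is μ‖a‖², to which the energy bound applies.
open Classical in
theorem le_eigenvalue_of_not_tiling (hL : 30 ≤ L) {κ : ℝ} (hκ : 0 < κ) (lam : ℂ)
    {v : Config L → ℂ} {μ : ℝ} (hv : (periodicHamiltonian L κ lam).mulVec v = (μ : ℂ) • v)
    {X₀ : Config L} (hX₀ : ¬ IsTiling X₀) (hv₀ : v X₀ ≠ 0) :
    1 / (2 + 4 / κ + 2 * ‖lam‖ ^ 2) ≤ μ := by
  set H := periodicHamiltonian L κ lam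
  set a : Config L → ℂ := fun X => if IsTiling X then 0 else v X with ha
  set s : Config L → ℂ := fun X => if IsTiling X then v X else 0 with hs
  have hsum : v = a + s := by
    funext X
    by_cases h : IsTiling X <;> simp [ha, hs, h]
  have haz : ∀ X, IsTiling X → a X = 0 := fun X hX => if_pos hX
  have hHa : ∀ X, IsTiling X → H.mulVec a X = 0 := by
    intro X hX
    rw [hX.periodicHamiltonian_mulVec (by omega)]
    refine mul_eq_zero_of_right _ (Finset.sum_eq_zero fun x _ => ?_)
    have h1 : IsDimer X x ∨ IsMonomerPair X x → a (toggle x X) = 0 := fun h =>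
      haz _ (hX.isTiling_toggle hL h)
    split_ifs with i1 i2 i2
    · simp [haz X hX, h1 (.inl i1)]
    · simp [haz X hX, h1 (.inl i1)]
    · simp [haz X hX, h1 (.inr i2)]
    · simp
  have hcross : star a ⬝ᵥ H.mulVec s = 0 := by
    have hH : H.conjTranspose = H := isHermitian_periodicHamiltonian κ lam
    have h1 : star (H.mulVec a) = Matrix.vecMul (star a) H := by
      rw [Matrix.star_mulVec, hH]
    rw [Matrix.dotProduct_mulVec, ← h1]
    refine Finset.sum_eq_zero fun X _ => ?_
    by_cases h : IsTiling X
    · simp [hHa X h]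
    · simp [hs, h]
  have hdiag : star a ⬝ᵥ v = star a ⬝ᵥ a := by
    refine Finset.sum_congr rfl fun X _ => ?_
    by_cases h : IsTiling X <;> simp [ha, h]
  have hen : star a ⬝ᵥ H.mulVec a = μ * (star a ⬝ᵥ a) := by
    have h1 : star a ⬝ᵥ H.mulVec v = star a ⬝ᵥ H.mulVec a := by
      rw [hsum, Matrix.mulVec_add, dotProduct_add, hcross, add_zero]
    rw [← h1, hv, dotProduct_smul, hdiag, smul_eq_mul]
  rw [star_dotProduct_periodicHamiltonian, star_dotProduct_self] at hen
  have hen' : electrostaticEnergy a + κ * ∑ x, ∑ Z, ‖(dipole lam x).mulVec a Z‖ ^ 2 =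
      μ * ∑ X, ‖a X‖ ^ 2 := by exact_mod_cast hen
  have hbound := sum_norm_sq_le hL hκ lam a haz
  have hdim := dimerEnergy_le (show 4 ≤ L by omega) lam a
  have hpos : 0 < ∑ X, ‖a X‖ ^ 2 := by
    refine Finset.sum_pos' (fun _ _ => by positivity) ⟨X₀, Finset.mem_univ _, ?_⟩
    have : a X₀ = v X₀ := if_neg hX₀
    rw [this]
    positivity
  have hC : 0 < 2 + 4 / κ + 2 * ‖lam‖ ^ 2 := by positivity
  have h2 : ∑ X, ‖a X‖ ^ 2 ≤ (2 + 4 / κ + 2 * ‖lam‖ ^ 2) * (μ * ∑ X, ‖a X‖ ^ 2) := by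
    refine hbound.trans ?_
    rw [← hen']
    gcongr
  rw [div_le_iff₀ hC]
  have h3 : 1 * ∑ X, ‖a X‖ ^ 2 ≤ (μ * (2 + 4 / κ + 2 * ‖lam‖ ^ 2)) * ∑ X, ‖a X‖ ^ 2 := by
    linarith
  exact le_of_mul_le_mul_right h3 hpos

theorem exists_eigenvector_of_mem_spectrum {ι : Type*} [Fintype ι] [DecidableEq ι]
    {H : Matrix ι ι ℂ} {μ : ℝ} (h : μ ∈ spectrum ℝ H) :
    ∃ v : ι → ℂ, v ≠ 0 ∧ H.mulVec v = (μ : ℂ) • v := by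
  rw [spectrum.mem_iff, Matrix.isUnit_iff_isUnit_det, isUnit_iff_ne_zero, not_not] at h
  obtain ⟨v, hv, hv'⟩ := Matrix.exists_mulVec_eq_zero_iff.2 h
  refine ⟨v, hv, ?_⟩
  rw [Matrix.sub_mulVec, sub_eq_zero, Algebra.algebraMap_eq_smul_one, Matrix.smul_mulVec,
    Matrix.one_mulVec] at hv'
  rw [← hv']
  funext i
  simp

theorem mem_spectrum_periodicHamiltonian (hL : 30 ≤ L) {κ : ℝ} (hκ : 0 < κ) {lam : ℂ}
    (hlam : lam ≠ 0) {μ : ℝ} (h : μ ∈ spectrum ℝ (periodicHamiltonian L κ lam)) :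
    μ = 0 ∨ min (1 / (2 + 4 / κ + 2 * ‖lam‖ ^ 2)) (κ / (1 + ‖lam‖ ^ 2)) ≤ μ := by
  obtain ⟨v, hv0, hv⟩ := exists_eigenvector_of_mem_spectrum h
  by_cases hc : ∀ X, ¬ IsTiling X → v X = 0
  · rcases eigenvalue_of_tilings hL hκ hlam (v := v) (μ := μ) fun X _ => by
      rw [hv, Pi.smul_apply, smul_eq_mul] with h1 | h1 | h1
    · refine absurd (funext fun X => ?_) hv0
      by_cases hX : IsTiling X
      · exact h1 X hX
      · exact hc X hX
    · exact .inl h1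
    · exact .inr ((min_le_right _ _).trans h1)
  · push Not at hc
    obtain ⟨X, hX, hX'⟩ := hc
    exact .inr ((min_le_left _ _).trans (le_eigenvalue_of_not_tiling hL hκ lam hv hX hX'))

/-- The empty configuration admits no move, so its row of the matrix vanishes. -/
theorem zero_mem_spectrum_periodicHamiltonian (hL : 4 ≤ L) (κ : ℝ) (lam : ℂ) :
    (0 : ℝ) ∈ spectrum ℝ (periodicHamiltonian L κ lam) := by
  have hvac : IsTiling (0 : Config L) := by constructor <;> intro y h <;> simp at h
  rw [spectrum.zero_mem_iff, Matrix.isUnit_iff_isUnit_det, isUnit_iff_ne_zero, not_not]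
  refine Matrix.det_eq_zero_of_row_eq_zero 0 fun Z => ?_
  have h := hvac.periodicHamiltonian_mulVec hL κ lam (Pi.single Z 1)
  rw [Matrix.mulVec_single_one] at h
  refine h.trans (mul_eq_zero_of_right _ (Finset.sum_eq_zero fun x _ => ?_))
  simp [IsDimer, IsMonomerPair]

/-- The fully occupied configuration has positive electrostatic energy. This supplies a nonzero
eigenvalue; otherwise the infimum defining the gap would run over the empty set and take the default
value 0. -/
theorem periodicHamiltonian_ne_zero (hL : 0 < L) {κ : ℝ} (hκ : 0 ≤ κ) (lam : ℂ) :
    periodicHamiltonian L κ lam ≠ 0 := by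
  intro h0
  have h := star_dotProduct_periodicHamiltonian κ lam (Pi.single (fun _ : Fin L => 1) 1)
  rw [h0, Matrix.zero_mulVec, dotProduct_zero] at h
  have h' : (0 : ℝ) = electrostaticEnergy (Pi.single (fun _ : Fin L => 1) 1) +
    κ * ∑ x, ∑ Z, ‖(dipole lam x).mulVec (Pi.single (fun _ : Fin L => 1) 1) Z‖ ^ 2 := by
      exact_mod_cast h
  have h1 : 0 ≤ κ * ∑ x : Fin L, ∑ Z,
      ‖(dipole lam x).mulVec (Pi.single (fun _ : Fin L => 1) 1) Z‖ ^ 2 := by positivity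
  have hnn : ∀ (x : Fin L) (X : Config L), 0 ≤ (if X x = 1 ∧ X (ringShift x 2) = 1 then
      ‖(Pi.single (fun _ : Fin L => 1) 1 : Config L → ℂ) X‖ ^ 2 else 0) := fun x X => by
    split_ifs <;> positivity
  have h2 : 1 ≤ electrostaticEnergy (Pi.single (fun _ : Fin L => 1) 1 : Config L → ℂ) := by
    refine le_trans ?_ (Finset.single_le_sum (fun x _ => Finset.sum_nonneg fun X _ => hnn x X)
      (Finset.mem_univ (⟨0, hL⟩ : Fin L)))
    refine le_trans ?_ (Finset.single_le_sum (fun X _ => hnn _ X)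
      (Finset.mem_univ (fun _ : Fin L => 1)))
    simp
  linarith

theorem exists_ne_zero_mem_spectrum {ι : Type*} [Fintype ι] [DecidableEq ι]
    {H : Matrix ι ι ℂ} (hH : H.IsHermitian) (h0 : H ≠ 0) : ∃ μ ∈ spectrum ℝ H, μ ≠ 0 := by
  by_contra! h
  refine h0 (hH.eigenvalues_eq_zero_iff.1 (funext fun i => ?_))
  exact h _ (hH.eigenvalues_mem_spectrum_real i)

theorem le_spectralGap_periodicHamiltonian (hL : 30 ≤ L) {κ : ℝ} (hκ : 0 < κ) {lam : ℂ}
    (hlam : lam ≠ 0) :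
    min (1 / (2 + 4 / κ + 2 * ‖lam‖ ^ 2)) (κ / (1 + ‖lam‖ ^ 2)) ≤
      spectralGap (periodicHamiltonian L κ lam) := by
  have hpos : 0 < min (1 / (2 + 4 / κ + 2 * ‖lam‖ ^ 2)) (κ / (1 + ‖lam‖ ^ 2)) := by positivity
  have hnn : ∀ μ ∈ spectrum ℝ (periodicHamiltonian L κ lam), 0 ≤ μ := fun μ hμ => by
    rcases mem_spectrum_periodicHamiltonian hL hκ hlam hμ with h | h
    · exact h.ge
    · exact hpos.le.trans h
  have hground : groundEnergy (periodicHamiltonian L κ lam) = 0 :=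
    IsLeast.csInf_eq ⟨zero_mem_spectrum_periodicHamiltonian (by omega) κ lam, hnn⟩
  unfold spectralGap
  simp only [hground, zero_add]
  refine le_csInf ?_ fun δ hδ => ?_
  · obtain ⟨μ, hμ, hne⟩ := exists_ne_zero_mem_spectrum (isHermitian_periodicHamiltonian κ lam)
      (periodicHamiltonian_ne_zero (show 0 < L by omega) hκ.le lam)
    exact ⟨μ, (hnn μ hμ).lt_of_ne' hne, hμ⟩
  · exact (mem_spectrum_periodicHamiltonian hL hκ hlam hδ.2).resolve_left hδ.1.ne'

theorem spectralGap_nonneg {ι : Type*} [Fintype ι] [DecidableEq ι] (H : Matrix ι ι ℂ) :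
    0 ≤ spectralGap H :=
  Real.sInf_nonneg fun _ hδ => hδ.1.le

/-- The constant splits as 2 + 4/κ + 2|λ|² = (2/κ + 2|λ|²) + 2(1/κ + 1), and γ^per times either
bracket is at most 1/3. -/
theorem gapBound_le {κ : ℝ} (hκ : 0 < κ) (lam : ℂ) {v : ℝ} (hv : v < 1 / 3) :
    gapBound κ lam v ≤ min (1 / (2 + 4 / κ + 2 * ‖lam‖ ^ 2)) (κ / (1 + ‖lam‖ ^ 2)) := by
  refine min_le_min ?_ ?_
  · have h1 : gammaPer κ lam ≤ 1 / 3 * (κ / (2 + 2 * κ * ‖lam‖ ^ 2)) :=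
      mul_le_mul_of_nonneg_left ((min_le_right _ _).trans (min_le_left _ _)) (by norm_num)
    have h2 : gammaPer κ lam ≤ 1 / 3 * (κ / (1 + κ)) :=
      mul_le_mul_of_nonneg_left ((min_le_right _ _).trans (min_le_right _ _)) (by norm_num)
    rw [le_div_iff₀ (by positivity)]
    have e1 : gammaPer κ lam * (2 / κ + 2 * ‖lam‖ ^ 2) ≤ 1 / 3 := by
      calc _ ≤ 1 / 3 * (κ / (2 + 2 * κ * ‖lam‖ ^ 2)) * (2 / κ + 2 * ‖lam‖ ^ 2) := by gcongr
        _ = 1 / 3 := by field_simp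
    have e2 : gammaPer κ lam * (1 / κ + 1) ≤ 1 / 3 := by
      calc _ ≤ 1 / 3 * (κ / (1 + κ)) * (1 / κ + 1) := by gcongr
        _ = 1 / 3 := by field_simp
    have e3 : gammaPer κ lam * (2 + 4 / κ + 2 * ‖lam‖ ^ 2) =
        gammaPer κ lam * (2 / κ + 2 * ‖lam‖ ^ 2) + 2 * (gammaPer κ lam * (1 / κ + 1)) := by
      ring
    linarith
  · have h0 : 0 ≤ √(3 * v) := Real.sqrt_nonneg _
    have h1 : √(3 * v) ≤ 1 := Real.sqrt_le_one.2 (by linarith)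
    have h2 : (1 - √(3 * v)) ^ 2 ≤ 1 := pow_le_one₀ (by linarith) (by linarith)
    have h3 : κ / (6 * (1 + 2 * ‖lam‖ ^ 2)) ≤ κ / (1 + ‖lam‖ ^ 2) := by
      refine div_le_div_of_nonneg_left hκ.le (by positivity) ?_
      nlinarith [sq_nonneg ‖lam‖]
    calc _ ≤ κ / (6 * (1 + 2 * ‖lam‖ ^ 2)) * 1 := by gcongr
      _ ≤ _ := by rwa [mul_one]

theorem gapBound_zero_le (lam : ℂ) (v : ℝ) : gapBound 0 lam v ≤ 0 :=
  (min_le_right _ _).trans (by simp)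

end Spectrum
end Haldane

/-! ### The theorem -/

theorem theorem1p1 :
    ∃ f : ℝ≥0 → ℝ≥0,
      -- `f` is the supremum of the explicit functions `f_k`, `k ≥ 4`, and is monotone increasing
      (∀ r : ℝ≥0, IsLUB {y : ℝ | ∃ k : ℕ, 4 ≤ k ∧ y = Haldane.fSeq k r} (f r)) ∧
      Monotone f ∧
      -- the uniform lower bound on the bulk gap
      (∀ (lam : ℂ) (κ : ℝ), lam ≠ 0 → (f (‖lam‖₊ ^ 2) : ℝ) < 1 / 3 → 0 ≤ κ →
        ((Haldane.gapBound κ lam (f (‖lam‖₊ ^ 2)) : ℝ) : EReal) ≤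
          Filter.liminf
            (fun L : ℕ =>
              ((Haldane.spectralGap (Haldane.periodicHamiltonian L κ lam) : ℝ) : EReal))
            Filter.atTop) ∧
      -- the bound applies to all small `lam ≠ 0` and stays positive as `lam → 0`
      (∀ᶠ lam : ℂ in 𝓝[≠] 0, (f (‖lam‖₊ ^ 2) : ℝ) < 1 / 3) ∧
      (∀ κ : ℝ, 0 < κ →
        0 < min 1 (min (κ / 2) (κ / (1 + κ))) / 3 ∧
        Filter.Tendsto (fun lam : ℂ => Haldane.gapBound κ lam (f (‖lam‖₊ ^ 2))) (𝓝[≠] 0)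
          (𝓝 (min 1 (min (κ / 2) (κ / (1 + κ))) / 3))) := by
  obtain ⟨f, hlub, hmono, hsq⟩ := Haldane.exists_sup_fSeq
  refine ⟨f, hlub, hmono, fun lam κ hlam hf hκ => ?_, ?_, fun κ hκ => ⟨by positivity, ?_⟩⟩
  · refine Filter.le_liminf_of_le (by isBoundedDefault) ?_
    filter_upwards [Filter.eventually_ge_atTop 30] with L hL
    rw [EReal.coe_le_coe_iff]
    -- For κ = 0 the bound is at most 0 and the gap is nonnegative as an infimum of positive
    -- numbers.
    rcases hκ.eq_or_lt with rfl | hκ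
    · exact (Haldane.gapBound_zero_le _ _).trans (Haldane.spectralGap_nonneg _)
    · exact (Haldane.gapBound_le hκ lam hf).trans
        (Haldane.le_spectralGap_periodicHamiltonian hL hκ hlam)
  · exact (Haldane.tendsto_sup_fSeq hsq).eventually_lt_const (by norm_num)
  · exact Haldane.tendsto_gapBound hsq hκ
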